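/- For $|q|<1$ let $(q;q)_n:=\prod_{j=1}^{n}(1-q^j)$ and $$G(q):=\sum_{n\ge 0}\frac{q^{n^2}}{(q;q)_n},\qquad H(q):=\sum_{n\ge 0}\frac{q^{n(n+1)}}{(q;q)_n}.$$ For $\tau$ in the upper half plane $\mathbb H$ put $q=e^{2\pi i\tau}$, $q^{\alpha}=e^{2\pi i\alpha\tau}$, and let $\mathbf f(\tau):=(f_1(\tau),f_2(\tau))^{\mathsf T}$ with $f_1(\tau):=q^{-1/60}G(q)$ and $f_2(\tau):=q^{11/60}H(q)$. A function $\mathbf f:\mathbb H\to\mathbb C^r$ is called a (weakly holomorphic) vector-valued modular function for a representation $\rho:\mathrm{SL}_2(\mathbb Z)\to\mathrm{GL}_r(\mathbb C)$ if its components are holomorphic on $\mathbb H$ and meromorphic at every cusp (that is, for each $\gamma\in \mathrm{SL}_2(\mathbb Z)$ each component of $\mathbf f(\gamma\tau)$ is, for some integer $w\ge 1$, a function of $e^{2\pi i\tau/w}$ that is meromorphic at $0$), and $\mathbf f(\gamma\tau)=\rho(\gamma)\mathbf f(\tau)$ for all $\gamma\in\mathrm{SL}_2(\mathbb Z)$ and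 $\tau\in\mathbb H$. Its level (up to a scalar multiplier) is the least integer $N\ge 1$ for which there is a character $\chi:\mathrm{SL}_2(\mathbb Z)\to\mathbb C^\times$ with $\rho(\gamma)=\chi(\gamma)I$ for all $\gamma\in\Gamma(N)$. **Theorem (Rogers–Ramanujan vector-valued modularity).** The series $G(q)$ and $H(q)$ converge absolutely for $|q|<1$, and $\mathbf f=(f_1,f_2)^{\mathsf T}$ is a two-dimensional vector-valued modular function of level $5$ for a representation $\rho$ of $\mathrm{SL}_2(\mathbb Z)$. In particular, for all $\tau\in\mathbb H$, $$\mathbf f(\tau+1)=\rho(T)\,\mathbf f(\tau)\qquad\text{and}\qquad \mathbf f(-1/\tau)=\rho(S)\,\mathbf f(\tau),$$ where $T=\begin{pmatrix}1&1\\0&1\end{pmatrix}$, $S=\begin{pmatrix}0&-1\\1&0\end{pmatrix}$ and $$\rho(T)=\begin{pmatrix}e^{-2\pi i/60}&0\\0&e^{11\cdot 2\pi i/60}\end{pmatrix},\qquad \rho(S)=\frac{2}{\sqrt5}\begin{pmatrix}\sin\frac{2\pi}{5}&\sin\frac{\pi}{5}\\ \sin\frac{\pi}{5}&-\sin\frac{2\pi}{5}\end{pmatrix}.$$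 -/

import Mathlib

open scoped Manifold MatrixGroups UpperHalfPlane

noncomputable section

/-- The finite `q`-Pochhammer symbol `(a;q)_n = ∏_{j=0}^{n-1} (1 - a q^j)`. -/
def qPoch (a q : ℂ) (n : ℕ) : ℂ := ∏ j ∈ Finset.range n, (1 - a * q ^ j)

/-- The `n`-th term of the first Rogers–Ramanujan series. -/
def rrTermG (q : ℂ) (n : ℕ) : ℂ := q ^ (n ^ 2) / qPoch q q n

/-- The `n`-th term of the second Rogers–Ramanujan series. -/
def rrTermH (q : ℂ) (n : ℕ) : ℂ := q ^ (n * (n + 1)) / qPoch q q n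

/-- `G(q) = ∑_{n ≥ 0} q^{n²} / (q;q)_n`. -/
def rrG (q : ℂ) : ℂ := ∑' n : ℕ, rrTermG q n

/-- `H(q) = ∑_{n ≥ 0} q^{n(n+1)} / (q;q)_n`. -/
def rrH (q : ℂ) : ℂ := ∑' n : ℕ, rrTermH q n

/-- The power `q^α = e^{2πiατ}` of `q = e^{2πiτ}`, as a function of `τ`. -/
def qPow (α : ℂ) (τ : ℍ) : ℂ := Complex.exp (2 * Real.pi * Complex.I * α * (τ : ℂ))

/-- The normalized Rogers–Ramanujan pair `(q^{-1/60} G(q), q^{11/60} H(q))`, `q = e^{2πiτ}`. -/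
def rrVector (τ : ℍ) : Fin 2 → ℂ :=
  ![qPow (-1 / 60) τ * rrG (qPow 1 τ), qPow (11 / 60) τ * rrH (qPow 1 τ)]

/-- `g` is meromorphic at the cusp `∞`: it is a function of `q^{1/w} = e^{2πiτ/w}`, for some
positive integer `w`, which is meromorphic at `q^{1/w} = 0`. -/
def MeromorphicAtInfty (g : ℍ → ℂ) : Prop :=
  ∃ w : ℕ, 0 < w ∧ ∃ F : ℂ → ℂ, MeromorphicAt F 0 ∧ ∀ τ : ℍ, g τ = F (qPow (1 / (w : ℂ)) τ)

/-- `f` is a weakly holomorphic `r`-dimensional vector-valued modular function for the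
representation `ρ` of `SL₂(ℤ)`: its components are holomorphic on the upper half plane and
meromorphic at every cusp, and `f(γτ) = ρ(γ) f(τ)`. -/
structure IsVVModularFunction {r : ℕ} (ρ : SL(2, ℤ) →* GL (Fin r) ℂ) (f : ℍ → Fin r → ℂ) :
    Prop where
  holomorphic : ∀ j, MDifferentiable 𝓘(ℂ) 𝓘(ℂ) (fun τ => f τ j)
  transform : ∀ (γ : SL(2, ℤ)) (τ : ℍ), f (γ • τ) = (ρ γ : Matrix (Fin r) (Fin r) ℂ).mulVec (f τ)
  meromorphic_cusps : ∀ (γ : SL(2, ℤ)) j, MeromorphicAtInfty (fun τ => f (γ • τ) j)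

/-- `Γ(N)` acts through `ρ` by scalars, given by a character `χ` of `SL₂(ℤ)`; equivalently, `ρ` is
the twist by a character of `SL₂(ℤ)` of a representation that is trivial on `Γ(N)`. -/
def ActsByMultiplier {r : ℕ} (ρ : SL(2, ℤ) →* GL (Fin r) ℂ) (N : ℕ) : Prop :=
  ∃ χ : SL(2, ℤ) →* ℂˣ, ∀ γ ∈ CongruenceSubgroup.Gamma N,
    (ρ γ : Matrix (Fin r) (Fin r) ℂ) = (χ γ : ℂ) • (1 : Matrix (Fin r) (Fin r) ℂ)

/-- The level of `ρ` (up to a scalar multiplier) is `N`: the least positive integer such that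
`Γ(N)` acts through a scalar multiplier. -/
def HasLevel {r : ℕ} (ρ : SL(2, ℤ) →* GL (Fin r) ℂ) (N : ℕ) : Prop :=
  IsLeast {M : ℕ | 0 < M ∧ ActsByMultiplier ρ M} N

/-- `diag(e^{-2πi/60}, e^{11·2πi/60})`. -/
def rrMatrixT : Matrix (Fin 2) (Fin 2) ℂ :=
  !![Complex.exp (-(2 * Real.pi * Complex.I) / 60), 0;
     0, Complex.exp (11 * (2 * Real.pi * Complex.I) / 60)]

/-- `(2/√5) · [[sin(2π/5), sin(π/5)], [sin(π/5), -sin(2π/5)]]`. -/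
def rrMatrixS : Matrix (Fin 2) (Fin 2) ℂ :=
  ((2 / Real.sqrt 5 : ℝ) : ℂ) •
    !![(Real.sin (2 * Real.pi / 5) : ℂ), (Real.sin (Real.pi / 5) : ℂ);
       (Real.sin (Real.pi / 5) : ℂ), -(Real.sin (2 * Real.pi / 5) : ℂ)]

end

open Filter Topology

noncomputable section

/-! The engine is the Rogers–Ramanujan identities in theta form. Put R_i = ∑ q^{n²+in}/(q;q)_n, so
that G = R_0 and H = R_1. Then R_i = R_{i+1} + q^{i+1} R_{i+2} and R_i → 1. Rogers' very-well-poised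
series, at a = q^{i+1} and multiplied by (q;q)_i, satisfy the same recurrence and tend to (q;q)_∞. A
null solution of the recurrence is zero, so the two agree up to the factor (q;q)_∞
(`qPoch_mul_wpSumTwo`). At a = q the quotients of Pochhammer symbols cancel and the series become
theta series, whence η f_1 = q^{1/40} θ_1 and η f_2 = q^{9/40} θ_3, with θ_k = ∑ (-1)^n
q^{(5n²+kn)/2} over n ∈ ℤ.

The law under S follows from the functional equation of Jacobi's theta function, which turns
θ_k(-1/τ) into a theta function of modulus τ/5. Splitting its summation index modulo 5 gives back
θ_1 and θ_3 (`jacobiTheta₂_dissection'`), and the coefficients are the sines of ρ(S). The square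
root of τ cancels against that of η. The law under T is read off the exponents.

Since S and T generate SL₂(ℤ), each f(γτ) is a matrix times f(τ). That matrix is unique because f_1
and f_2 are linearly independent, so the matrices form a representation, and every cusp reduces to
∞. For the level, ρ(S) and ρ(T) are scalar multiples of matrices generating a two-dimensional
representation of SL₂(ℤ/5), so Γ(5) acts by a character. Conversely the eigenvalues of ρ(T) have
ratio e^{2πi/5}, so T^M acts as a scalar only if 5 ∣ M. -/

/-! ### Convergence and the recurrence of the Rogers–Ramanujan sums -/

theorem summable_pow_choose_two_mul_pow {r : ℝ} (hr0 : 0 ≤ r) (hr : r < 1) (B : ℝ) :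
    Summable fun n : ℕ => r ^ n.choose 2 * B ^ n := by
  rcases eq_or_ne B 0 with rfl | hB
  · exact summable_of_ne_finset_zero (s := {0}) fun n hn => by simp_all
  -- The ratio test needs nonzero terms. For r = 0 only n = 0 and n = 1 survive, since 0 ^ 0 = 1.
  rcases hr0.eq_or_lt with rfl | hr0
  · refine summable_of_ne_finset_zero (s := {0, 1}) fun n hn => ?_
    have : n.choose 2 ≠ 0 := by
      simp only [Finset.mem_insert, Finset.mem_singleton, not_or] at hn
      exact (Nat.choose_pos (by omega)).ne'
    simp [this]
  have hne (n : ℕ) : r ^ n.choose 2 * B ^ n ≠ 0 := by positivity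
  refine summable_of_ratio_test_tendsto_lt_one (l := 0) one_pos (.of_forall hne) ?_
  have h : ∀ n : ℕ, ‖r ^ (n + 1).choose 2 * B ^ (n + 1)‖ / ‖r ^ n.choose 2 * B ^ n‖ =
      r ^ n * ‖B‖ := fun n => by
    rw [div_eq_iff (norm_ne_zero_iff.mpr (hne n)), Nat.choose_succ_succ' n 1, Nat.choose_one_right]
    simp only [norm_mul, norm_pow, Real.norm_of_nonneg hr0.le]
    ring
  simp_rw [h]
  simpa using (tendsto_pow_atTop_nhds_zero_of_lt_one hr0.le hr).mul_const ‖B‖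

theorem qPoch_zero (a q : ℂ) : qPoch a q 0 = 1 := by simp [qPoch]

theorem qPoch_succ (a q : ℂ) (n : ℕ) :
    qPoch a q (n + 1) = qPoch a q n * (1 - a * q ^ n) := by
  simp [qPoch, Finset.prod_range_succ]

theorem qPoch_succ' (a q : ℂ) (n : ℕ) :
    qPoch a q (n + 1) = (1 - a) * qPoch (a * q) q n := by
  simp only [qPoch, Finset.prod_range_succ', pow_zero, mul_one]
  rw [mul_comm]
  exact congrArg _ (Finset.prod_congr rfl fun j _ => by ring)

theorem norm_qPoch_le {a q : ℂ} (ha : ‖a‖ ≤ 1) (hq : ‖q‖ ≤ 1) (n : ℕ) :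
    ‖qPoch a q n‖ ≤ 2 ^ n := by
  rw [qPoch, norm_prod]
  refine (Finset.prod_le_prod (fun _ _ => norm_nonneg _) (g := fun _ => (2 : ℝ)) fun j _ => ?_).trans
    (by simp)
  refine (norm_sub_le _ _).trans ?_
  rw [norm_one, norm_mul, norm_pow]
  have := mul_le_one₀ ha (by positivity) (pow_le_one₀ (n := j) (norm_nonneg q) hq)
  linarith

theorem le_norm_qPoch_self {q : ℂ} {r : ℝ} (hq : ‖q‖ ≤ r) (hr : r < 1) (n : ℕ) :
    (1 - r) ^ n ≤ ‖qPoch q q n‖ := by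
  induction n with
  | zero => simp [qPoch]
  | succ n ih =>
    rw [qPoch_succ, norm_mul, pow_succ]
    refine mul_le_mul ih ?_ (by linarith) (norm_nonneg _)
    refine le_trans ?_ (norm_sub_norm_le _ _)
    rw [norm_one, norm_mul, norm_pow]
    have := mul_le_of_le_one_right (norm_nonneg q)
      (pow_le_one₀ (n := n) (norm_nonneg q) (hq.trans hr.le))
    linarith

theorem qPoch_self_ne_zero {q : ℂ} (hq : ‖q‖ < 1) (n : ℕ) : qPoch q q n ≠ 0 := by
  rw [← norm_pos_iff]
  exact (pow_pos (sub_pos.mpr hq) n).trans_le (le_norm_qPoch_self le_rfl hq n)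

theorem norm_inv_qPoch_self_le {q : ℂ} {r : ℝ} (hq : ‖q‖ ≤ r) (hr : r < 1) (n : ℕ) :
    ‖(qPoch q q n)⁻¹‖ ≤ (1 - r)⁻¹ ^ n := by
  rw [norm_inv, inv_pow]
  exact inv_anti₀ (pow_pos (by linarith) n) (le_norm_qPoch_self hq hr n)

/-- The `n`-th term of `∑ q^{n² + in} / (q;q)_n`. -/
def rrTerm (q : ℂ) (i n : ℕ) : ℂ := q ^ (n ^ 2 + i * n) / qPoch q q n

theorem rrTermG_eq (q : ℂ) : rrTermG q = rrTerm q 0 := by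
  ext n; simp [rrTermG, rrTerm]

theorem rrTermH_eq (q : ℂ) : rrTermH q = rrTerm q 1 := by
  ext n; simp [rrTermH, rrTerm, mul_add, sq]

/-- The majorant depends neither on i nor on q in the disc of radius r: it serves both the limit i →
∞ and termwise differentiation. -/
theorem norm_rrTerm_le {q : ℂ} {r : ℝ} (hq : ‖q‖ ≤ r) (hr : r < 1) (i n : ℕ) :
    ‖rrTerm q i n‖ ≤ r ^ n.choose 2 * (1 - r)⁻¹ ^ n := by
  have hr0 : 0 ≤ r := (norm_nonneg q).trans hq
  rw [rrTerm, div_eq_mul_inv, norm_mul, norm_pow]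
  refine mul_le_mul ((pow_le_pow_left₀ (norm_nonneg q) hq _).trans
    (pow_le_pow_of_le_one hr0 hr.le ?_)) (norm_inv_qPoch_self_le hq hr n) (norm_nonneg _)
    (pow_nonneg hr0 _)
  rw [Nat.choose_two_right]
  refine (Nat.div_le_self _ _).trans ((Nat.mul_le_mul_left n (Nat.sub_le n 1)).trans ?_)
  rw [sq]; exact Nat.le_add_right _ _

theorem summable_norm_rrTerm {q : ℂ} (hq : ‖q‖ < 1) (i : ℕ) :
    Summable fun n => ‖rrTerm q i n‖ :=
  (summable_pow_choose_two_mul_pow (norm_nonneg q) hq _).of_nonneg_of_le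
    (fun _ => norm_nonneg _) fun n => norm_rrTerm_le le_rfl hq i n

/-- `∑ q^{n² + in} / (q;q)_n`. -/
def rrSum (q : ℂ) (i : ℕ) : ℂ := ∑' n, rrTerm q i n

/-- The difference of the n-th terms carries a factor 1 - q^n, which cancels the last factor of
(q;q)_n; then n is shifted by one. -/
theorem rrSum_recurrence {q : ℂ} (hq : ‖q‖ < 1) (i : ℕ) :
    rrSum q i = rrSum q (i + 1) + q ^ (i + 1) * rrSum q (i + 2) := by
  have hs (i : ℕ) : Summable (rrTerm q i) := (summable_norm_rrTerm hq i).of_norm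
  have h0 : rrTerm q i 0 - rrTerm q (i + 1) 0 = 0 := by simp [rrTerm]
  have h1 (n : ℕ) : rrTerm q i (n + 1) - rrTerm q (i + 1) (n + 1) =
      q ^ (i + 1) * rrTerm q (i + 2) n := by
    have := qPoch_self_ne_zero hq n
    have h2 := qPoch_self_ne_zero hq (n + 1)
    rw [qPoch_succ, mul_ne_zero_iff] at h2
    have h3 := h2.2
    simp only [rrTerm, qPoch_succ]
    field_simp
    ring
  rw [← sub_eq_iff_eq_add', rrSum, rrSum, ← (hs i).tsum_sub (hs (i + 1)),
    ((hs i).sub (hs (i + 1))).tsum_eq_zero_add, h0, zero_add, rrSum, ← tsum_mul_left]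
  exact tsum_congr h1

theorem tendsto_rrSum {q : ℂ} (hq : ‖q‖ < 1) : Tendsto (rrSum q) atTop (𝓝 1) := by
  unfold rrSum
  have h : Tendsto (fun i => ∑' n, rrTerm q i n) atTop
      (𝓝 (∑' n : ℕ, if n = 0 then (1 : ℂ) else 0)) := by
    refine tendsto_tsum_of_dominated_convergence
      (summable_pow_choose_two_mul_pow (norm_nonneg q) hq (1 - ‖q‖)⁻¹) (fun n => ?_)
      (.of_forall fun i n => norm_rrTerm_le le_rfl hq i n)
    rcases eq_or_ne n 0 with rfl | hn
    · simp [rrTerm, qPoch_zero]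
    · simp only [rrTerm, hn, if_false, pow_add]
      have : Tendsto (fun i : ℕ => q ^ (i * n)) atTop (𝓝 0) := by
        simp_rw [mul_comm _ n, pow_mul]
        exact tendsto_pow_atTop_nhds_zero_of_norm_lt_one
          (by rw [norm_pow]; exact pow_lt_one₀ (norm_nonneg q) hq hn)
      simpa using (this.const_mul (q ^ n ^ 2)).div_const (qPoch q q n)
  simpa using h

/-! ### Very-well-poised series and the Rogers–Ramanujan identities -/

/-- The common factor of the terms of the very-well-poised series below. -/
def wpBase (m : ℕ) (q a : ℂ) (n : ℕ) : ℂ :=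
  (-1) ^ n * a ^ (2 * n) * q ^ (5 * n.choose 2 + m * n) * (qPoch a q n / qPoch q q n)

theorem norm_wpBase_le (m : ℕ) {q a : ℂ} (hq : ‖q‖ < 1) (ha : ‖a‖ ≤ 1) (n : ℕ) :
    ‖wpBase m q a n‖ ≤ ‖q‖ ^ n.choose 2 * (2 * (1 - ‖q‖)⁻¹) ^ n := by
  have h1 : ‖q‖ ^ (5 * n.choose 2 + m * n) ≤ ‖q‖ ^ n.choose 2 :=
    pow_le_pow_of_le_one (norm_nonneg q) hq.le (by nlinarith)
  have h2 : ‖a‖ ^ (2 * n) ≤ 1 := pow_le_one₀ (norm_nonneg a) ha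
  have h4 := norm_qPoch_le ha hq.le n
  have h5 := norm_inv_qPoch_self_le le_rfl hq n
  have h6 : 0 < 1 - ‖q‖ := sub_pos.mpr hq
  rw [wpBase, div_eq_mul_inv]
  simp only [norm_mul, norm_pow, norm_neg, norm_one, one_pow, one_mul]
  calc _ ≤ 1 * ‖q‖ ^ n.choose 2 * (2 ^ n * (1 - ‖q‖)⁻¹ ^ n) := by gcongr
    _ = _ := by rw [mul_pow]; ring

theorem norm_one_sub_mul_pow_le {a q : ℂ} (ha : ‖a‖ ≤ 1) (hq : ‖q‖ ≤ 1) (m k : ℕ) :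
    ‖1 - a ^ m * q ^ k‖ ≤ 2 := by
  refine (norm_sub_le _ _).trans ?_
  rw [norm_one, norm_mul, norm_pow, norm_pow]
  have := mul_le_one₀ (pow_le_one₀ (n := m) (norm_nonneg a) ha) (by positivity)
    (pow_le_one₀ (n := k) (norm_nonneg q) hq)
  linarith

theorem norm_wpBase_mul_le (m : ℕ) {q a x : ℂ} (hq : ‖q‖ < 1) (ha : ‖a‖ ≤ 1) (hx : ‖x‖ ≤ 2)
    (n : ℕ) : ‖wpBase m q a n * x‖ ≤ ‖q‖ ^ n.choose 2 * (2 * (1 - ‖q‖)⁻¹) ^ n * 2 := by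
  rw [norm_mul]
  exact mul_le_mul (norm_wpBase_le m hq ha n) hx (norm_nonneg _)
    ((norm_nonneg _).trans (norm_wpBase_le m hq ha n))

theorem summable_wpBase_mul (m : ℕ) {q a : ℂ} {x : ℕ → ℂ} (hq : ‖q‖ < 1) (ha : ‖a‖ ≤ 1)
    (hx : ∀ n, ‖x n‖ ≤ 2) : Summable fun n => wpBase m q a n * x n :=
  .of_norm_bounded ((summable_pow_choose_two_mul_pow (norm_nonneg q) hq _).mul_right 2)
    fun n => norm_wpBase_mul_le m hq ha (hx n) n

/-- The terms of `wpSumOne`. -/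
def wpTermOne (q a : ℂ) (n : ℕ) : ℂ := wpBase 2 q a n * (1 - a ^ 1 * q ^ (2 * n))

/-- The terms of `wpSumTwo`. -/
def wpTermTwo (q a : ℂ) (n : ℕ) : ℂ := wpBase 1 q a n * (1 - a ^ 2 * q ^ (4 * n))

/-- The first very-well-poised series of the Rogers–Ramanujan recursion. -/
def wpSumOne (q a : ℂ) : ℂ := ∑' n, wpTermOne q a n

/-- The second very-well-poised series of the Rogers–Ramanujan recursion. -/
def wpSumTwo (q a : ℂ) : ℂ := ∑' n, wpTermTwo q a n

theorem summable_wpTermOne {q a : ℂ} (hq : ‖q‖ < 1) (ha : ‖a‖ ≤ 1) : Summable (wpTermOne q a) :=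
  summable_wpBase_mul 2 hq ha fun n => norm_one_sub_mul_pow_le ha hq.le 1 (2 * n)

theorem summable_wpTermTwo {q a : ℂ} (hq : ‖q‖ < 1) (ha : ‖a‖ ≤ 1) : Summable (wpTermTwo q a) :=
  summable_wpBase_mul 1 hq ha fun n => norm_one_sub_mul_pow_le ha hq.le 2 (4 * n)

/-- Summation by telescoping: two series agree when their terms differ by the increments of a
summable sequence starting at 0. -/
theorem tsum_eq_of_shift {f g u : ℕ → ℂ} (hf : Summable f) (hu : Summable u) (hu0 : u 0 = 0)
    (h : ∀ n, f n + (u (n + 1) - u n) = g n) : ∑' n, f n = ∑' n, g n := by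
  have h1 : Summable fun n => u (n + 1) := (summable_nat_add_iff 1).mpr hu
  have h2 : ∑' n, (u (n + 1) - u n) = 0 := by
    rw [h1.tsum_sub hu, hu.tsum_eq_zero_add, hu0]; ring
  rw [← add_zero (∑' n, f n), ← h2, ← hf.tsum_add (h1.sub hu)]
  exact tsum_congr h

theorem wpBase_succ_mul (m : ℕ) {q : ℂ} (a : ℂ) (hq : ‖q‖ < 1) (n : ℕ) :
    wpBase m q a (n + 1) * (1 - 1 ^ 0 * q ^ (n + 1)) =
      -(wpBase m q a n * (a ^ 2 * q ^ (5 * n + m) * (1 - a * q ^ n))) := by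
  have h := qPoch_self_ne_zero hq n
  have h2 := qPoch_self_ne_zero hq (n + 1)
  rw [qPoch_succ, mul_ne_zero_iff] at h2
  have h3 : 1 - q ^ (n + 1) ≠ 0 := by rw [pow_succ']; exact h2.2
  simp only [wpBase, qPoch_succ, ← pow_succ', Nat.choose_succ_succ' n 1, Nat.choose_one_right]
  field_simp
  ring

theorem one_sub_mul_wpBase_mul (m : ℕ) (q a : ℂ) (n : ℕ) :
    (1 - a) * wpBase m q (a * q) n = wpBase m q a n * (q ^ (2 * n) * (1 - a * q ^ n)) := by
  have h := (qPoch_succ' a q n).symm.trans (qPoch_succ a q n)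
  simp only [wpBase]
  linear_combination (-1) ^ n * (a * q) ^ (2 * n) * q ^ (5 * n.choose 2 + m * n) /
    qPoch q q n * h

theorem wpBase_two (q a : ℂ) (n : ℕ) : wpBase 2 q a n = wpBase 1 q a n * q ^ n := by
  simp only [wpBase]; ring

theorem wpSumOne_eq {q a : ℂ} (hq : ‖q‖ < 1) (ha : ‖a‖ ≤ 1) :
    wpSumOne q a = (1 - a) * wpSumTwo q (a * q) := by
  rw [wpSumTwo, ← tsum_mul_left]
  -- The factor 1 - q^n makes u vanish at 0 and cancels the new denominator factor in u (n + 1). It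
  -- is written with `1 ^ 0` to fit the shape of `norm_one_sub_mul_pow_le`.
  refine tsum_eq_of_shift (u := fun n => wpBase 2 q a n * (1 - 1 ^ 0 * q ^ n))
    (summable_wpTermOne hq ha) (summable_wpBase_mul 2 hq ha fun n =>
      norm_one_sub_mul_pow_le (by simp) hq.le 0 n) (by simp) fun n => ?_
  rw [wpBase_succ_mul 2 a hq, wpTermOne, wpTermTwo, ← mul_assoc (1 - a),
    one_sub_mul_wpBase_mul, wpBase_two]
  ring

theorem wpSumTwo_eq {q a : ℂ} (hq : ‖q‖ < 1) (ha : ‖a‖ ≤ 1) :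
    wpSumTwo q a = wpSumOne q a + a * (1 - a) * wpSumOne q (a * q) := by
  rw [← sub_eq_iff_eq_add', wpSumOne, wpSumTwo, wpSumOne,
    ← (summable_wpTermTwo hq ha).tsum_sub (summable_wpTermOne hq ha), ← tsum_mul_left]
  refine tsum_eq_of_shift (u := fun n => wpBase 1 q a n * (1 - 1 ^ 0 * q ^ n))
    ((summable_wpTermTwo hq ha).sub (summable_wpTermOne hq ha))
    (summable_wpBase_mul 1 hq ha fun n =>
      norm_one_sub_mul_pow_le (by simp) hq.le 0 n) (by simp) fun n => ?_
  rw [wpBase_succ_mul 1 a hq, wpTermOne, wpTermTwo, wpTermOne, mul_assoc a,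
    ← mul_assoc (1 - a), one_sub_mul_wpBase_mul, wpBase_two]
  ring

theorem tendsto_wpSumTwo {q : ℂ} (hq : ‖q‖ < 1) :
    Tendsto (fun i : ℕ => wpSumTwo q (q ^ (i + 1))) atTop (𝓝 1) := by
  unfold wpSumTwo
  have h : Tendsto (fun i : ℕ => ∑' n, wpTermTwo q (q ^ (i + 1)) n) atTop
      (𝓝 (∑' n : ℕ, if n = 0 then (1 : ℂ) else 0)) := by
    have hle (i : ℕ) : ‖q ^ (i + 1)‖ ≤ 1 := by
      rw [norm_pow]; exact pow_le_one₀ (norm_nonneg q) hq.le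
    have ht : Tendsto (fun i : ℕ => q ^ (i + 1)) atTop (𝓝 0) :=
      (tendsto_pow_atTop_nhds_zero_of_norm_lt_one hq).comp (tendsto_add_atTop_nat 1)
    refine tendsto_tsum_of_dominated_convergence
      ((summable_pow_choose_two_mul_pow (norm_nonneg q) hq _).mul_right 2) (fun n => ?_)
      (.of_forall fun i n => norm_wpBase_mul_le 1 hq (hle i)
        (norm_one_sub_mul_pow_le (hle i) hq.le 2 (4 * n)) n)
    have hc : Continuous fun a => wpTermTwo q a n := by
      unfold wpTermTwo wpBase qPoch; fun_prop
    refine ((hc.tendsto 0).comp ht).trans (le_of_eq ?_)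
    rcases eq_or_ne n 0 with rfl | hn
    · simp [wpTermTwo, wpBase, qPoch_zero]
    · simp [wpTermTwo, wpBase, hn]
  simpa using h

/-- A null sequence with `d i = d (i + 1) + q ^ (i + 1) * d (i + 2)` vanishes. -/
theorem eq_zero_of_recurrence {q : ℂ} (hq : ‖q‖ < 1) {d : ℕ → ℂ}
    (h : ∀ i, d i = d (i + 1) + q ^ (i + 1) * d (i + 2)) (hd : Tendsto d atTop (𝓝 0)) (i : ℕ) :
    d i = 0 := by
  set M : ℕ → ℝ := fun i => max ‖d i‖ ‖d (i + 1)‖ with hM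
  have hM0 (i) : 0 ≤ M i := le_max_of_le_left (norm_nonneg _)
  have hstep (i : ℕ) : M i ≤ (1 + ‖q‖ ^ (i + 1)) * M (i + 1) := by
    have h1 : ‖d (i + 1)‖ ≤ M (i + 1) := le_max_left _ _
    have h2 : ‖d (i + 2)‖ ≤ M (i + 1) := le_max_right _ _
    have hp : 0 ≤ ‖q‖ ^ (i + 1) := by positivity
    refine max_le ?_ (by nlinarith [hM0 (i + 1)])
    rw [h i]
    refine (norm_add_le _ _).trans ?_
    rw [norm_mul, norm_pow]
    nlinarith [mul_le_mul_of_nonneg_left h2 hp]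
  -- The exponent is minus the geometric tail ∑_{k > i} ‖q‖^k. This weight absorbs the factors 1 +
  -- ‖q‖^{i+1} ≤ exp(‖q‖^{i+1}), so the weighted maxima increase to their limit 0.
  have hexp (i : ℕ) : M i * Real.exp (-(‖q‖ ^ (i + 1) / (1 - ‖q‖))) ≤
      M (i + 1) * Real.exp (-(‖q‖ ^ (i + 2) / (1 - ‖q‖))) := by
    have h0 : 0 < 1 - ‖q‖ := sub_pos.mpr hq
    have h1 : -(‖q‖ ^ (i + 2) / (1 - ‖q‖)) =
        ‖q‖ ^ (i + 1) + -(‖q‖ ^ (i + 1) / (1 - ‖q‖)) := by field_simp; ring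
    rw [h1, Real.exp_add, ← mul_assoc]
    refine mul_le_mul_of_nonneg_right ((hstep i).trans ?_) (Real.exp_pos _).le
    rw [mul_comm]
    exact mul_le_mul_of_nonneg_left (by rw [add_comm]; exact Real.add_one_le_exp _) (hM0 _)
  have hmono := monotone_nat_of_le_succ hexp
  have hlim : Tendsto (fun i => M i * Real.exp (-(‖q‖ ^ (i + 1) / (1 - ‖q‖)))) atTop (𝓝 0) := by
    have hM1 : Tendsto M atTop (𝓝 0) := by
      simpa using hd.norm.max (hd.comp (tendsto_add_atTop_nat 1)).norm
    have := ((tendsto_pow_atTop_nhds_zero_of_lt_one (norm_nonneg q) hq).comp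
      (tendsto_add_atTop_nat 1)).div_const (1 - ‖q‖)
    simpa using hM1.mul ((Real.continuous_exp.tendsto _).comp this.neg)
  have hle := hmono.ge_of_tendsto hlim i
  have hMi : M i ≤ 0 := nonpos_of_mul_nonpos_left hle (Real.exp_pos _)
  exact norm_le_zero_iff.mp ((le_max_left _ _).trans hMi)

theorem tendsto_qPoch_self {q : ℂ} (hq : ‖q‖ < 1) :
    Tendsto (qPoch q q) atTop (𝓝 (∏' n : ℕ, (1 - q ^ (n + 1)))) := by
  have := (ModularForm.multipliable_one_sub_pow hq).hasProd.tendsto_prod_nat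
  refine this.congr fun n => ?_
  simp [qPoch, pow_succ']

/-- Eliminating `wpSumOne` from `wpSumOne_eq` and `wpSumTwo_eq` gives F(a) = (1-a)F(aq) +
a(1-a)(1-aq)F(aq²). At a = q^{i+1} the factor (q;q)_i absorbs the coefficients and leaves the
recurrence of `rrSum`; both sides tend to (q;q)_∞. -/
theorem qPoch_mul_wpSumTwo {q : ℂ} (hq : ‖q‖ < 1) (i : ℕ) :
    qPoch q q i * wpSumTwo q (q ^ (i + 1)) = (∏' n : ℕ, (1 - q ^ (n + 1))) * rrSum q i := by
  have hle (i : ℕ) : ‖q ^ (i + 1)‖ ≤ 1 := by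
    rw [norm_pow]; exact pow_le_one₀ (norm_nonneg q) hq.le
  rw [← sub_eq_zero]
  refine eq_zero_of_recurrence hq (d := fun i => qPoch q q i * wpSumTwo q (q ^ (i + 1)) -
    (∏' n : ℕ, (1 - q ^ (n + 1))) * rrSum q i) (fun i => ?_) ?_ i
  · have h1 := wpSumTwo_eq hq (hle i)
    rw [wpSumOne_eq hq (hle i), ← pow_succ, wpSumOne_eq hq (hle (i + 1)), ← pow_succ] at h1
    simp only [h1, qPoch_succ, rrSum_recurrence hq i]
    ring
  · simpa using ((tendsto_qPoch_self hq).mul (tendsto_wpSumTwo hq)).sub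
      ((tendsto_rrSum hq).const_mul (∏' n : ℕ, (1 - q ^ (n + 1))))

theorem tprod_mul_rrG {q : ℂ} (hq : ‖q‖ < 1) :
    (∏' n : ℕ, (1 - q ^ (n + 1))) * rrG q = wpSumTwo q q := by
  have := qPoch_mul_wpSumTwo hq 0
  rw [qPoch_zero] at this
  rw [rrG, rrTermG_eq, ← rrSum, ← this]
  simp

theorem tprod_mul_rrH {q : ℂ} (hq : ‖q‖ < 1) :
    (∏' n : ℕ, (1 - q ^ (n + 1))) * rrH q = wpSumOne q q := by
  rw [rrH, rrTermH_eq, ← rrSum, ← qPoch_mul_wpSumTwo hq 1, wpSumOne_eq hq hq.le]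
  simp [qPoch, sq]

theorem differentiableOn_rrSum (i : ℕ) :
    DifferentiableOn ℂ (fun q => rrSum q i) (Metric.ball 0 1) := by
  intro q hq
  obtain ⟨r, hqr, hr⟩ := exists_between (mem_ball_zero_iff.mp hq)
  have h : DifferentiableOn ℂ (fun q => rrSum q i) (Metric.ball 0 r) := by
    refine Complex.differentiableOn_tsum_of_summable_norm (summable_pow_choose_two_mul_pow
      ((norm_nonneg q).trans hqr.le) hr (1 - r)⁻¹) (fun n z hz => ?_) Metric.isOpen_ball
      fun n z hz => norm_rrTerm_le (mem_ball_zero_iff.mp hz).le hr i n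
    have hz1 : qPoch z z n ≠ 0 := qPoch_self_ne_zero ((mem_ball_zero_iff.mp hz).trans hr) n
    refine DifferentiableAt.differentiableWithinAt (DifferentiableAt.div (by fun_prop) ?_ hz1)
    unfold qPoch; fun_prop
  exact ((h q (by simpa using hqr)).differentiableAt
    (Metric.isOpen_ball.mem_nhds (by simpa using hqr))).differentiableWithinAt

/-! ### Theta series, their dissection modulo 5 and their inversion -/

/-- The theta series `∑ (-1)^n q^{(5n² + kn)/2}`, `q = e^{2πiτ}`. -/
def rrTheta (k : ℤ) (τ : ℂ) : ℂ := jacobiTheta₂ (1 / 2 + k * τ / 2) (5 * τ)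

theorem neg_one_pow_eq_exp (n : ℕ) : (-1 : ℂ) ^ n = Complex.exp (n * (Real.pi * Complex.I)) := by
  rw [Complex.exp_nat_mul, Complex.exp_pi_mul_I]

theorem exp_eq_exp_of_int {x y : ℂ} (n : ℤ) (h : x = y + n * (2 * Real.pi * Complex.I)) :
    Complex.exp x = Complex.exp y :=
  Complex.exp_eq_exp_iff_exists_int.mpr ⟨n, h⟩

theorem five_mul_im_pos {τ : ℂ} (hτ : 0 < τ.im) : 0 < (5 * τ).im := by simpa using hτ

theorem rrTheta_eq_tsum_nat (k : ℤ) {τ : ℂ} (hτ : 0 < τ.im) :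
    rrTheta k τ = ∑' n : ℕ, (jacobiTheta₂_term n (1 / 2 + k * τ / 2) (5 * τ) +
      jacobiTheta₂_term (-(n + 1)) (1 / 2 + k * τ / 2) (5 * τ)) := by
  have hs := (summable_jacobiTheta₂_term_iff (1 / 2 + k * τ / 2) (5 * τ)).mpr (five_mul_im_pos hτ)
  suffices H : ∀ f : ℤ → ℂ, Summable f → ∑' n, f n = ∑' n : ℕ, (f n + f (-(n + 1))) from H _ hs
  intro f hs
  have h1 : Summable fun n : ℕ => f n := hs.comp_injective Nat.cast_injective
  have h2 : Summable fun n : ℕ => f (-(n + 1)) :=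
    hs.comp_injective (i := fun n : ℕ => -((n : ℤ) + 1)) fun m n h => by simpa using h
  rw [tsum_of_nat_of_neg_add_one h1 h2, h1.tsum_add h2]

theorem norm_exp_two_pi_I_mul_lt_one {τ : ℂ} (hτ : 0 < τ.im) :
    ‖Complex.exp (2 * Real.pi * Complex.I * τ)‖ < 1 :=
  UpperHalfPlane.norm_exp_two_pi_I_lt_one ⟨τ, hτ⟩

theorem wpBase_self {q : ℂ} (hq : ‖q‖ < 1) (m n : ℕ) :
    wpBase m q q n = (-1) ^ n * q ^ (5 * n.choose 2 + (m + 2) * n) := by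
  rw [wpBase, div_self (qPoch_self_ne_zero hq n)]
  ring

/-- At a = q the factor 1 - q^{4n+2} splits the n-th term into the theta terms of indices n and
-(n+1). -/
theorem wpSumTwo_eq_rrTheta {τ : ℂ} (hτ : 0 < τ.im) :
    wpSumTwo (Complex.exp (2 * Real.pi * Complex.I * τ))
      (Complex.exp (2 * Real.pi * Complex.I * τ)) = rrTheta 1 τ := by
  rw [rrTheta_eq_tsum_nat 1 hτ]
  refine tsum_congr fun n => ?_
  rw [wpTermTwo, wpBase_self (norm_exp_two_pi_I_mul_lt_one hτ), mul_sub, mul_one, sub_eq_add_neg]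
  simp only [neg_one_pow_eq_exp, ← Complex.exp_nat_mul, ← Complex.exp_add, jacobiTheta₂_term]
  congr 1
  · congr 1
    push_cast [Nat.cast_choose_two]
    ring
  · rw [← neg_one_mul, ← Complex.exp_pi_mul_I, ← Complex.exp_add]
    refine exp_eq_exp_of_int (n + 1) ?_
    push_cast [Nat.cast_choose_two]
    ring

theorem wpSumOne_eq_rrTheta {τ : ℂ} (hτ : 0 < τ.im) :
    wpSumOne (Complex.exp (2 * Real.pi * Complex.I * τ))
      (Complex.exp (2 * Real.pi * Complex.I * τ)) = rrTheta 3 τ := by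
  rw [rrTheta_eq_tsum_nat 3 hτ]
  refine tsum_congr fun n => ?_
  rw [wpTermOne, wpBase_self (norm_exp_two_pi_I_mul_lt_one hτ), mul_sub, mul_one, sub_eq_add_neg]
  simp only [neg_one_pow_eq_exp, ← Complex.exp_nat_mul, ← Complex.exp_add, jacobiTheta₂_term]
  congr 1
  · congr 1
    push_cast [Nat.cast_choose_two]
    ring
  · rw [← neg_one_mul, ← Complex.exp_pi_mul_I, ← Complex.exp_add]
    refine exp_eq_exp_of_int (n + 1) ?_
    push_cast [Nat.cast_choose_two]
    ring

theorem rrTheta_neg (k : ℤ) (τ : ℂ) : rrTheta (-k) τ = rrTheta k τ := by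
  rw [rrTheta, ← jacobiTheta₂_neg_left, ← jacobiTheta₂_add_left, rrTheta]
  congr 1
  push_cast
  ring

/-- Translation by the quasi-period 5τ sends k = -5 to k = 5 with factor -1, whereas θ_k is even in
k. -/
theorem rrTheta_five (τ : ℂ) : rrTheta 5 τ = 0 := by
  have h := jacobiTheta₂_add_left' (1 / 2 + ((-5 : ℤ) : ℂ) * τ / 2) (5 * τ)
  have h1 : 1 / 2 + ((-5 : ℤ) : ℂ) * τ / 2 + 5 * τ = 1 / 2 + ((5 : ℤ) : ℂ) * τ / 2 := by
    push_cast; ring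
  have h2 : Complex.exp (-Real.pi * Complex.I *
      (5 * τ + 2 * (1 / 2 + ((-5 : ℤ) : ℂ) * τ / 2))) = -1 := by
    rw [← Complex.exp_pi_mul_I]
    refine exp_eq_exp_of_int (-1) ?_
    push_cast; ring
  rw [h1, h2, ← rrTheta, ← rrTheta, rrTheta_neg] at h
  linear_combination h / 2

/-- The index is written n = 5m + j - 2. The shift by 2 produces k = -3, -1, 1, 3, 5, which evenness
and the vanishing of θ_5 reduce to k = 1 and k = 3. -/
theorem jacobiTheta₂_dissection (e : ℤ) {τ : ℂ} (hτ : 0 < τ.im) :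
    jacobiTheta₂ ((τ - (2 * e + 1)) / 10) (τ / 5) = ∑ j : Fin 5,
      Complex.exp (Real.pi * Complex.I * (τ * ((j - 2) ^ 2 + (j - 2)) / 5 -
        (2 * e + 1) * (j - 2) / 5)) * rrTheta (2 * (j : ℕ) - 3) τ := by
  have hτ' : 0 < (τ / 5).im := by simpa using hτ
  have hs := (summable_jacobiTheta₂_term_iff ((τ - (2 * e + 1)) / 10) (τ / 5)).mpr hτ'
  let E : Fin 5 × ℤ ≃ ℤ :=
    ((Equiv.prodComm _ _).trans (Int.divModEquiv 5).symm).trans (Equiv.subRight 2)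
  have hE (p : Fin 5 × ℤ) : E p = 5 * p.2 + ((p.1 : ℕ) : ℤ) - 2 := by
    simp [E, Int.divModEquiv, mul_comm, add_comm]
  rw [jacobiTheta₂, ← E.tsum_eq]
  refine (E.summable_iff.mpr hs).tsum_prod.trans ?_
  rw [tsum_fintype]
  refine Finset.sum_congr rfl fun j _ => ?_
  rw [rrTheta, jacobiTheta₂, ← tsum_mul_left]
  refine tsum_congr fun m => ?_
  rw [Function.comp_apply, hE, jacobiTheta₂_term, jacobiTheta₂_term, ← Complex.exp_add]
  refine exp_eq_exp_of_int (-(e + 1) * m) ?_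
  push_cast
  ring

theorem jacobiTheta₂_dissection' (e : ℤ) {τ : ℂ} (hτ : 0 < τ.im) :
    jacobiTheta₂ ((τ - (2 * e + 1)) / 10) (τ / 5) =
      (1 + Complex.exp (Real.pi * Complex.I * ((2 * e + 1) / 5))) * rrTheta 1 τ +
      Complex.exp (Real.pi * Complex.I * (2 * τ / 5)) *
        (Complex.exp (Real.pi * Complex.I * (-(2 * e + 1) / 5)) +
          Complex.exp (Real.pi * Complex.I * (2 * (2 * e + 1) / 5))) * rrTheta 3 τ := by
  rw [jacobiTheta₂_dissection e hτ, Fin.sum_univ_five]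
  have h3 : rrTheta (-3) τ = rrTheta 3 τ := rrTheta_neg 3 τ
  have h1 : rrTheta (-1) τ = rrTheta 1 τ := rrTheta_neg 1 τ
  norm_num [h3, h1, rrTheta_five]
  rw [mul_add, ← Complex.exp_add, ← Complex.exp_add]
  ring_nf

theorem rrTheta_neg_inv (e : ℤ) {τ : ℂ} (hτ : 0 < τ.im) :
    Complex.exp (Real.pi * Complex.I * (2 * e + 1) ^ 2 * (-τ⁻¹) / 20) *
      rrTheta (2 * e + 1) (-τ⁻¹) =
    (-Complex.I * (τ / 5)) ^ (1 / 2 : ℂ) * Complex.exp (Real.pi * Complex.I * τ / 20) *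
      Complex.exp (-(Real.pi * Complex.I * (2 * e + 1) / 10)) *
      jacobiTheta₂ ((τ - (2 * e + 1)) / 10) (τ / 5) := by
  have h0 : τ ≠ 0 := by rintro rfl; simp at hτ
  have hc : (-Complex.I * (τ / 5)) ^ (1 / 2 : ℂ) ≠ 0 := by simp [Complex.cpow_eq_zero_iff, h0]
  rw [jacobiTheta₂_functional_equation ((τ - (2 * e + 1)) / 10) (τ / 5)]
  have hz : (τ - (2 * e + 1)) / 10 / (τ / 5) = 1 / 2 + ((2 * e + 1 : ℤ) : ℂ) * -τ⁻¹ / 2 := by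
    push_cast; field_simp; ring
  have ht : -1 / (τ / 5) = 5 * -τ⁻¹ := by field_simp
  rw [hz, ht, ← rrTheta]
  set c := (-Complex.I * (τ / 5)) ^ (1 / 2 : ℂ)
  have : Complex.exp (Real.pi * Complex.I * (2 * e + 1) ^ 2 * (-τ⁻¹) / 20) =
      Complex.exp (Real.pi * Complex.I * τ / 20) *
      Complex.exp (-(Real.pi * Complex.I * (2 * e + 1) / 10)) *
      Complex.exp (-Real.pi * Complex.I * ((τ - (2 * e + 1)) / 10) ^ 2 / (τ / 5)) := by
    rw [← Complex.exp_add, ← Complex.exp_add]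
    congr 1
    field_simp
    ring
  rw [this]
  field_simp

/-! ### From theta series to the vector f: the laws under S and T -/

theorem exp_mul_rrG {τ : ℂ} (hτ : 0 < τ.im) :
    ModularForm.eta τ * (Complex.exp (2 * Real.pi * Complex.I * (-1 / 60) * τ) *
      rrG (Complex.exp (2 * Real.pi * Complex.I * τ))) =
    Complex.exp (Real.pi * Complex.I * τ / 20) * rrTheta 1 τ := by
  have h := tprod_mul_rrG (norm_exp_two_pi_I_mul_lt_one hτ)
  rw [wpSumTwo_eq_rrTheta hτ] at h
  have h2 : Complex.exp (Real.pi * Complex.I * τ / 20) = Function.Periodic.qParam 24 τ *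
      Complex.exp (2 * Real.pi * Complex.I * (-1 / 60) * τ) := by
    rw [Function.Periodic.qParam, ← Complex.exp_add]
    congr 1; push_cast; ring
  rw [← h, h2, ModularForm.eta]
  simp only [ModularForm.eta_q_eq_pow]
  ring

theorem exp_mul_rrH {τ : ℂ} (hτ : 0 < τ.im) :
    ModularForm.eta τ * (Complex.exp (2 * Real.pi * Complex.I * (11 / 60) * τ) *
      rrH (Complex.exp (2 * Real.pi * Complex.I * τ))) =
    Complex.exp (Real.pi * Complex.I * 9 * τ / 20) * rrTheta 3 τ := by
  have h := tprod_mul_rrH (norm_exp_two_pi_I_mul_lt_one hτ)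
  rw [wpSumOne_eq_rrTheta hτ] at h
  have h2 : Complex.exp (Real.pi * Complex.I * 9 * τ / 20) = Function.Periodic.qParam 24 τ *
      Complex.exp (2 * Real.pi * Complex.I * (11 / 60) * τ) := by
    rw [Function.Periodic.qParam, ← Complex.exp_add]
    congr 1; push_cast; ring
  rw [← h, h2, ModularForm.eta]
  simp only [ModularForm.eta_q_eq_pow]
  ring

/-- No branch jump occurs: the right side has imaginary part arg τ - π/2, which lies in (-π, π].
This matches the square root in the theta inversion with the one in the law of η. -/
theorem log_neg_I_mul_div {τ : ℂ} (hτ : 0 < τ.im) :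
    Complex.log (-Complex.I * (τ / 5)) = Complex.log τ - Complex.log Complex.I - Real.log 5 := by
  have h0 : τ ≠ 0 := by rintro rfl; simp at hτ
  have him : (Complex.log τ - Complex.log Complex.I - Real.log 5).im = τ.arg - Real.pi / 2 := by
    simp [Complex.log_im]
  have h1 := (Complex.arg_mem_Ioc τ).2
  have h2 : 0 ≤ τ.arg := Complex.arg_nonneg_iff.mpr hτ.le
  rw [← Complex.log_exp (x := Complex.log τ - Complex.log Complex.I - Real.log 5)
    (by rw [him]; linarith [Real.pi_pos]) (by rw [him]; linarith [Real.pi_pos])]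
  congr 1
  rw [Complex.exp_sub, Complex.exp_sub, Complex.exp_log h0, Complex.exp_log Complex.I_ne_zero,
    ← Complex.ofReal_exp, Real.exp_log (by norm_num)]
  simp [div_eq_mul_inv]
  ring

theorem eta_neg_inv {τ : ℂ} (hτ : 0 < τ.im) :
    (-Complex.I * (τ / 5)) ^ (1 / 2 : ℂ) * ModularForm.eta τ =
      ((1 / Real.sqrt 5 : ℝ) : ℂ) * ModularForm.eta (-τ⁻¹) := by
  have h0 : τ ≠ 0 := by rintro rfl; simp at hτ
  have h := ModularForm.eta_comp_eq_csqrt_I_inv hτ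
  simp only [Function.comp_apply, Pi.smul_apply, Pi.mul_apply, smul_eq_mul] at h
  rw [show -τ⁻¹ = -1 / τ by field_simp, h, ← mul_assoc, ← mul_assoc]
  congr 1
  have h5 : ((1 / Real.sqrt 5 : ℝ) : ℂ) = Complex.exp (-(Real.log 5 / 2)) := by
    rw [Real.sqrt_eq_rpow, one_div, ← Real.rpow_neg (by norm_num),
      Real.rpow_def_of_pos (by norm_num)]
    push_cast
    congr 1; ring
  rw [Complex.cpow_def_of_ne_zero (by simp [h0]), log_neg_I_mul_div hτ, h5,
    sqrt_eq_exp Complex.I_ne_zero, sqrt_eq_exp h0, ← Complex.exp_neg,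
    ← Complex.exp_add, ← Complex.exp_add]
  congr 1
  ring

theorem two_mul_sin_two_pi_div_five :
    ((2 * Real.sin (2 * Real.pi / 5) : ℝ) : ℂ) =
      Complex.exp (Real.pi * Complex.I / 10) + Complex.exp (-(Real.pi * Complex.I / 10)) := by
  rw [← Real.cos_pi_div_two_sub]
  push_cast
  rw [Complex.two_cos]
  congr 2 <;> ring

theorem two_mul_sin_pi_div_five :
    ((2 * Real.sin (Real.pi / 5) : ℝ) : ℂ) =
      Complex.exp (3 * (Real.pi * Complex.I / 10)) +
        Complex.exp (-(3 * (Real.pi * Complex.I / 10))) := by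
  rw [← Real.cos_pi_div_two_sub]
  push_cast
  rw [Complex.two_cos]
  congr 2 <;> ring

theorem eta_mul_rrVector_zero (τ : ℍ) :
    ModularForm.eta τ * rrVector τ 0 =
      Complex.exp (Real.pi * Complex.I * τ / 20) * rrTheta 1 τ := by
  rw [← exp_mul_rrG τ.2]
  simp [rrVector, qPow]

theorem eta_mul_rrVector_one (τ : ℍ) :
    ModularForm.eta τ * rrVector τ 1 =
      Complex.exp (Real.pi * Complex.I * 9 * τ / 20) * rrTheta 3 τ := by
  rw [← exp_mul_rrH τ.2]
  simp [rrVector, qPow]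

theorem eta_mul_rrVector_neg_inv_zero (τ : ℍ) :
    ModularForm.eta (-(τ : ℂ)⁻¹) *
      rrVector (UpperHalfPlane.mk (-(τ : ℂ))⁻¹ τ.im_inv_neg_coe_pos) 0 =
    (-Complex.I * (τ / 5)) ^ (1 / 2 : ℂ) * ModularForm.eta τ *
      (((2 * Real.sin (2 * Real.pi / 5) : ℝ) : ℂ) * rrVector τ 0 +
        ((2 * Real.sin (Real.pi / 5) : ℝ) : ℂ) * rrVector τ 1) := by
  have h := eta_mul_rrVector_zero (UpperHalfPlane.mk (-(τ : ℂ))⁻¹ τ.im_inv_neg_coe_pos)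
  have hS := rrTheta_neg_inv 0 τ.2
  have hD := jacobiTheta₂_dissection' 0 τ.2
  have h0 := eta_mul_rrVector_zero τ
  have h1 := eta_mul_rrVector_one τ
  simp only [inv_neg, Int.cast_zero, mul_zero, zero_add, mul_one, one_pow] at h hS hD
  simp only [inv_neg]
  rw [h, hS, hD, two_mul_sin_two_pi_div_five, two_mul_sin_pi_div_five]
  have e1 : Complex.exp (Real.pi * Complex.I * 9 * τ / 20) =
    Complex.exp (Real.pi * Complex.I * τ / 20) * Complex.exp (Real.pi * Complex.I * (2 * τ / 5)) := by
    rw [← Complex.exp_add]; congr 1; ring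
  have e2 : Complex.exp (-(Real.pi * Complex.I / 10)) *
      (1 + Complex.exp (Real.pi * Complex.I * (1 / 5))) =
      Complex.exp (Real.pi * Complex.I / 10) + Complex.exp (-(Real.pi * Complex.I / 10)) := by
    rw [mul_add, ← Complex.exp_add, mul_one, add_comm]; congr 2; ring
  have e3 : Complex.exp (-(Real.pi * Complex.I / 10)) *
      (Complex.exp (Real.pi * Complex.I * (-1 / 5)) +
        Complex.exp (Real.pi * Complex.I * (2 / 5))) =
      Complex.exp (3 * (Real.pi * Complex.I / 10)) +
        Complex.exp (-(3 * (Real.pi * Complex.I / 10))) := by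
    rw [mul_add, ← Complex.exp_add, ← Complex.exp_add, add_comm]; congr 2 <;> ring
  rw [← e2, ← e3]
  rw [e1] at h1
  generalize rrTheta 1 τ = A at *
  generalize rrTheta 3 τ = B at *
  linear_combination
    (-(-Complex.I * (τ / 5)) ^ (1 / 2 : ℂ)) * (Complex.exp (-(Real.pi * Complex.I / 10)) *
      (1 + Complex.exp (Real.pi * Complex.I * (1 / 5)))) * h0 +
    (-(-Complex.I * (τ / 5)) ^ (1 / 2 : ℂ)) * (Complex.exp (-(Real.pi * Complex.I / 10)) *
      (Complex.exp (Real.pi * Complex.I * (-1 / 5)) +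
        Complex.exp (Real.pi * Complex.I * (2 / 5)))) * h1

theorem eta_mul_rrVector_neg_inv_one (τ : ℍ) :
    ModularForm.eta (-(τ : ℂ)⁻¹) *
      rrVector (UpperHalfPlane.mk (-(τ : ℂ))⁻¹ τ.im_inv_neg_coe_pos) 1 =
    (-Complex.I * (τ / 5)) ^ (1 / 2 : ℂ) * ModularForm.eta τ *
      (((2 * Real.sin (Real.pi / 5) : ℝ) : ℂ) * rrVector τ 0 -
        ((2 * Real.sin (2 * Real.pi / 5) : ℝ) : ℂ) * rrVector τ 1) := by
  have h := eta_mul_rrVector_one (UpperHalfPlane.mk (-(τ : ℂ))⁻¹ τ.im_inv_neg_coe_pos)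
  have hS := rrTheta_neg_inv 1 τ.2
  have hD := jacobiTheta₂_dissection' 1 τ.2
  have h0 := eta_mul_rrVector_zero τ
  have h1 := eta_mul_rrVector_one τ
  norm_num only [inv_neg, Int.cast_one] at h hS hD
  simp only [inv_neg]
  rw [h, hS, hD, two_mul_sin_two_pi_div_five, two_mul_sin_pi_div_five]
  have e1 : Complex.exp (Real.pi * Complex.I * 9 * τ / 20) =
    Complex.exp (Real.pi * Complex.I * τ / 20) * Complex.exp (Real.pi * Complex.I * (2 * τ / 5)) := by
    rw [← Complex.exp_add]; congr 1; ring
  have e2 : Complex.exp (-(Real.pi * Complex.I * 3 / 10)) *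
      (1 + Complex.exp (Real.pi * Complex.I * (3 / 5))) =
      Complex.exp (3 * (Real.pi * Complex.I / 10)) +
        Complex.exp (-(3 * (Real.pi * Complex.I / 10))) := by
    rw [mul_add, ← Complex.exp_add, mul_one, add_comm]; congr 2 <;> ring
  have e3 : Complex.exp (-(Real.pi * Complex.I * 3 / 10)) *
      (Complex.exp (Real.pi * Complex.I * -(3 / 5)) +
        Complex.exp (Real.pi * Complex.I * (6 / 5))) =
      -(Complex.exp (Real.pi * Complex.I / 10) + Complex.exp (-(Real.pi * Complex.I / 10))) := by
    have hneg (x : ℂ) : -Complex.exp x = Complex.exp (Real.pi * Complex.I + x) := by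
      rw [Complex.exp_add, Complex.exp_pi_mul_I, neg_one_mul]
    rw [mul_add, ← Complex.exp_add, ← Complex.exp_add, neg_add, hneg, hneg]
    congr 1
    · refine exp_eq_exp_of_int (-1) ?_
      push_cast; ring
    · congr 1; ring
  rw [sub_eq_add_neg, ← neg_mul (Complex.exp (Real.pi * Complex.I / 10) + _), ← e2, ← e3]
  rw [e1] at h1
  generalize rrTheta 1 τ = A at *
  generalize rrTheta 3 τ = B at *
  linear_combination
    (-(-Complex.I * (τ / 5)) ^ (1 / 2 : ℂ)) * (Complex.exp (-(Real.pi * Complex.I * 3 / 10)) *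
      (1 + Complex.exp (Real.pi * Complex.I * (3 / 5)))) * h0 +
    (-(-Complex.I * (τ / 5)) ^ (1 / 2 : ℂ)) * (Complex.exp (-(Real.pi * Complex.I * 3 / 10)) *
      (Complex.exp (Real.pi * Complex.I * -(3 / 5)) +
        Complex.exp (Real.pi * Complex.I * (6 / 5)))) * h1

theorem rrVector_neg_inv (τ : ℍ) :
    rrVector (UpperHalfPlane.mk (-(τ : ℂ))⁻¹ τ.im_inv_neg_coe_pos) =
      rrMatrixS.mulVec (rrVector τ) := by
  have hη : ModularForm.eta (-(τ : ℂ)⁻¹) ≠ 0 := by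
    rw [← inv_neg]; exact ModularForm.eta_ne_zero τ.im_inv_neg_coe_pos
  have h0 := eta_mul_rrVector_neg_inv_zero τ
  have h1 := eta_mul_rrVector_neg_inv_one τ
  rw [eta_neg_inv τ.2] at h0 h1
  ext j
  apply mul_left_cancel₀ hη
  fin_cases j
  · simp only [Fin.zero_eta, h0, rrMatrixS, Matrix.mulVec, dotProduct,
      Fin.sum_univ_two]
    simp
    ring
  · simp only [Fin.mk_one, h1, rrMatrixS, Matrix.mulVec, dotProduct,
      Fin.sum_univ_two]
    simp
    ring

theorem qPow_one_vadd (α : ℂ) (τ : ℍ) :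
    qPow α ((1 : ℝ) +ᵥ τ) = Complex.exp (2 * Real.pi * Complex.I * α) * qPow α τ := by
  rw [qPow, qPow, ← Complex.exp_add, UpperHalfPlane.coe_vadd]
  congr 1; push_cast; ring

theorem rrVector_one_vadd (τ : ℍ) :
    rrVector ((1 : ℝ) +ᵥ τ) = rrMatrixT.mulVec (rrVector τ) := by
  have h1 : qPow 1 ((1 : ℝ) +ᵥ τ) = qPow 1 τ := by
    rw [qPow_one_vadd, mul_one, Complex.exp_two_pi_mul_I, one_mul]
  ext j
  fin_cases j
  · simp [rrVector, h1, qPow_one_vadd, rrMatrixT, Matrix.mulVec, dotProduct, mul_assoc]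
    left; congr 1; ring
  · simp [rrVector, h1, qPow_one_vadd, rrMatrixT, Matrix.mulVec, dotProduct, mul_assoc]
    left; congr 1; ring

/-! ### Holomorphy, behaviour at the cusps, linear independence -/

theorem rrG_eq_rrSum : rrG = fun q => rrSum q 0 := by
  ext q; rw [rrG, rrTermG_eq, rrSum]

theorem rrH_eq_rrSum : rrH = fun q => rrSum q 1 := by
  ext q; rw [rrH, rrTermH_eq, rrSum]

theorem rrSum_zero_left (i : ℕ) : rrSum 0 i = 1 := by
  rw [rrSum, tsum_eq_single 0 fun n hn => by simp [rrTerm, hn]]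
  simp [rrTerm, qPoch_zero]

theorem mdifferentiable_rrVector (j : Fin 2) :
    MDifferentiable 𝓘(ℂ) 𝓘(ℂ) (fun τ => rrVector τ j) := by
  have h (α : ℂ) (i : ℕ) :
      MDifferentiable 𝓘(ℂ) 𝓘(ℂ) (fun τ : ℍ => qPow α τ * rrSum (qPow 1 τ) i) := by
    rw [UpperHalfPlane.mdifferentiable_iff]
    have hd : DifferentiableOn ℂ (fun z : ℂ => Complex.exp (2 * Real.pi * Complex.I * α * z) *
        rrSum (Complex.exp (2 * Real.pi * Complex.I * 1 * z)) i) {z | 0 < z.im} := by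
      refine DifferentiableOn.mul (by fun_prop)
        ((differentiableOn_rrSum i).comp (by fun_prop) fun z hz => ?_)
      simpa using norm_exp_two_pi_I_mul_lt_one hz
    refine hd.congr fun z hz => ?_
    simp [qPow, UpperHalfPlane.ofComplex_apply_of_im_pos hz]
  fin_cases j
  · simpa [rrVector, rrG_eq_rrSum] using h (-1 / 60) 0
  · simpa [rrVector, rrH_eq_rrSum] using h (11 / 60) 1

theorem qPow_natCast_mul (n : ℕ) (α : ℂ) (τ : ℍ) : qPow (n * α) τ = qPow α τ ^ n := by
  rw [qPow, qPow, ← Complex.exp_nat_mul]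
  congr 1; ring

theorem qPow_neg (α : ℂ) (τ : ℍ) : qPow (-α) τ = (qPow α τ)⁻¹ := by
  rw [qPow, qPow, ← Complex.exp_neg]
  congr 1; ring

theorem meromorphicAt_rrSum_pow (i : ℕ) :
    MeromorphicAt (fun x : ℂ => rrSum (x ^ 60) i) 0 := by
  have h1 : AnalyticAt ℂ (fun q => rrSum q i) ((0 : ℂ) ^ 60) :=
    (differentiableOn_rrSum i).analyticAt (Metric.isOpen_ball.mem_nhds (by simp))
  exact (h1.comp_of_eq (g := fun q => rrSum q i) (f := fun x : ℂ => x ^ 60) (by fun_prop)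
    rfl).meromorphicAt

theorem meromorphicAtInfty_linearCombination_rrVector (a b : ℂ) :
    MeromorphicAtInfty fun τ => a * rrVector τ 0 + b * rrVector τ 1 := by
  -- Here x = q^{1/60}, so q^{-1/60} and q^{11/60} become x⁻¹ and x^11.
  refine ⟨60, by norm_num, fun x => a * (x⁻¹ * rrSum (x ^ 60) 0) +
    b * (x ^ 11 * rrSum (x ^ 60) 1), ?_, fun τ => ?_⟩
  · have h0 := meromorphicAt_rrSum_pow 0
    have h1 := meromorphicAt_rrSum_pow 1
    have hx : MeromorphicAt (fun x : ℂ => x) 0 := MeromorphicAt.id 0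
    exact ((MeromorphicAt.const a 0).mul (hx.inv.mul h0)).add
      ((MeromorphicAt.const b 0).mul ((hx.pow 11).mul h1))
  · beta_reduce
    rw [← qPow_natCast_mul, ← qPow_natCast_mul, ← qPow_neg]
    simp only [rrVector, rrG_eq_rrSum, rrH_eq_rrSum]
    norm_num

theorem qPow_ne_zero (α : ℂ) (τ : ℍ) : qPow α τ ≠ 0 := Complex.exp_ne_zero _

theorem exists_rrSum_qPow_ne_zero (i : ℕ) : ∃ τ : ℍ, rrSum (qPow 1 τ) i ≠ 0 := by
  have h1 : ContinuousAt (fun q => rrSum q i) 0 :=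
    ((differentiableOn_rrSum i).differentiableAt
      (Metric.isOpen_ball.mem_nhds (by simp))).continuousAt
  have h2 : ∀ᶠ q in 𝓝 (0 : ℂ), rrSum q i ≠ 0 :=
    h1.eventually_ne (by rw [rrSum_zero_left]; exact one_ne_zero)
  obtain ⟨ε, hε, hb⟩ := Metric.eventually_nhds_iff.mp h2
  obtain ⟨t, ht, hpos⟩ : ∃ t : ℝ, Real.exp (-(2 * Real.pi) * t) < ε ∧ 0 < t := by
    have : Tendsto (fun t : ℝ => Real.exp (-(2 * Real.pi) * t)) atTop (𝓝 0) :=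
      Real.tendsto_exp_atBot.comp
        (tendsto_id.const_mul_atTop_of_neg (by linarith [Real.pi_pos]))
    exact ((this.eventually (gt_mem_nhds hε)).and (eventually_gt_atTop 0)).exists
  refine ⟨⟨t * Complex.I, by simpa using hpos⟩, hb ?_⟩
  rw [dist_zero_right, qPow, Complex.norm_exp]
  convert ht using 2
  simp

/-- Replacing τ by τ + 1 multiplies the components by distinct scalars, as 11/60 + 1/60 is not an
integer; so each summand vanishes separately. -/
theorem rrVector_linearIndependent {a b : ℂ} (h : ∀ τ, a * rrVector τ 0 + b * rrVector τ 1 = 0) :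
    a = 0 ∧ b = 0 := by
  have hz : Complex.exp (2 * Real.pi * Complex.I * (-1 / 60)) ≠
      Complex.exp (2 * Real.pi * Complex.I * (11 / 60)) := by
    rw [Ne, Complex.exp_eq_exp_iff_exists_int]
    rintro ⟨n, hn⟩
    have h0 : (2 * Real.pi * Complex.I) ≠ 0 := by simp [Real.pi_ne_zero]
    have h1 : (-1 / 60 : ℂ) = 11 / 60 + n := mul_left_cancel₀ h0 (by rw [hn]; ring)
    have h2 : (((-1 : ℤ)) : ℂ) = ((5 * n : ℤ) : ℂ) := by push_cast; linear_combination 5 * h1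
    have := Int.cast_injective h2
    omega
  have hT (τ : ℍ) : a * rrVector τ 0 = 0 ∧ b * rrVector τ 1 = 0 := by
    have h1 := h τ
    have h2 := h ((1 : ℝ) +ᵥ τ)
    have hq : qPow 1 ((1 : ℝ) +ᵥ τ) = qPow 1 τ := by
      rw [qPow_one_vadd, mul_one, Complex.exp_two_pi_mul_I, one_mul]
    simp only [rrVector, Matrix.cons_val_zero, Matrix.cons_val_one, qPow_one_vadd (-1 / 60),
      qPow_one_vadd (11 / 60), hq] at h1 h2 ⊢
    set u := qPow (-1 / 60) τ * rrG (qPow 1 τ)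
    set v := qPow (11 / 60) τ * rrH (qPow 1 τ)
    have h3 := sub_ne_zero.mpr hz
    constructor
    · refine (mul_eq_zero.mp (?_ : _ * (a * u) = 0)).resolve_left h3
      linear_combination h2 - Complex.exp (2 * Real.pi * Complex.I * (11 / 60)) * h1
    · refine (mul_eq_zero.mp (?_ : _ * (b * v) = 0)).resolve_left h3
      linear_combination -h2 + Complex.exp (2 * Real.pi * Complex.I * (-1 / 60)) * h1
  constructor
  · obtain ⟨τ, hτ⟩ := exists_rrSum_qPow_ne_zero 0
    exact (mul_eq_zero.mp (hT τ).1).resolve_right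
      (by simpa [rrVector, rrG_eq_rrSum] using ⟨qPow_ne_zero _ τ, hτ⟩)
  · obtain ⟨τ, hτ⟩ := exists_rrSum_qPow_ne_zero 1
    exact (mul_eq_zero.mp (hT τ).2).resolve_right
      (by simpa [rrVector, rrH_eq_rrSum] using ⟨qPow_ne_zero _ τ, hτ⟩)

/-! ### A two-dimensional representation of SL₂(ℤ/5) -/

/-- The primitive fifth root of unity `e^{2πi/5}`. -/
def zetaFive : ℂ := Complex.exp (2 * Real.pi * Complex.I / 5)

theorem isPrimitiveRoot_zetaFive : IsPrimitiveRoot zetaFive 5 := by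
  simpa [zetaFive] using Complex.isPrimitiveRoot_exp 5 (by norm_num)

theorem zetaFive_geom :
    1 + zetaFive + zetaFive ^ 2 + zetaFive ^ 3 + zetaFive ^ 4 = 0 := by
  simpa [Finset.sum_range_succ] using isPrimitiveRoot_zetaFive.geom_sum_eq_zero (by norm_num)

/-- The additive character `x ↦ e^{2πix/5}` of `ℤ/5`. -/
def expFive (x : ZMod 5) : ℂ := zetaFive ^ x.val

theorem expFive_add (x y : ZMod 5) : expFive (x + y) = expFive x * expFive y := by
  rw [expFive, expFive, expFive, ← pow_add, ZMod.val_add,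
    ← pow_eq_pow_mod _ isPrimitiveRoot_zetaFive.pow_eq_one]

theorem expFive_zero : expFive 0 = 1 := by simp [expFive]

/-- The image of `T ^ x` under the two-dimensional representation of `SL₂(ℤ/5)`. -/
def weilT (x : ZMod 5) : Matrix (Fin 2) (Fin 2) ℂ := !![expFive (2 * x), 0; 0, expFive (3 * x)]

/-- The image of `S` under the two-dimensional representation of `SL₂(ℤ/5)`. -/
def weilS : Matrix (Fin 2) (Fin 2) ℂ :=
  !![-(zetaFive + 2 * zetaFive ^ 2 - 2 * zetaFive ^ 3 - zetaFive ^ 4) / 5,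
     -(2 * zetaFive - zetaFive ^ 2 + zetaFive ^ 3 - 2 * zetaFive ^ 4) / 5;
     -(2 * zetaFive - zetaFive ^ 2 + zetaFive ^ 3 - 2 * zetaFive ^ 4) / 5,
     (zetaFive + 2 * zetaFive ^ 2 - 2 * zetaFive ^ 3 - zetaFive ^ 4) / 5]

/-- The image of `diag(c⁻¹, c)` under the two-dimensional representation of `SL₂(ℤ/5)`. -/
def weilDiag (c : ZMod 5) : Matrix (Fin 2) (Fin 2) ℂ :=
  if c = 1 then 1 else if c = 2 then !![0, 1; -1, 0] else if c = 3 then !![0, -1; 1, 0] else -1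

/-- The two-dimensional representation of `SL₂(ℤ/5)`, through the Bruhat decomposition. -/
def weilRep (m : Matrix (Fin 2) (Fin 2) (ZMod 5)) : Matrix (Fin 2) (Fin 2) ℂ :=
  if m 1 0 = 0 then weilT (m 0 1 * (m 1 1)⁻¹) * weilDiag (m 1 1)
  else weilT (m 0 0 * (m 1 0)⁻¹) * weilDiag (m 1 0) * weilS * weilT (m 1 1 * (m 1 0)⁻¹)

theorem weilT_add (x y : ZMod 5) : weilT (x + y) = weilT x * weilT y := by
  simp [weilT, mul_add, expFive_add]

theorem weilT_zero : weilT 0 = 1 := by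
  simp [weilT, expFive_zero, Matrix.one_fin_two]

instance fact_prime_five : Fact (Nat.Prime 5) := ⟨by norm_num⟩

theorem zmod_five_inv_two : (2 : ZMod 5)⁻¹ = 3 := inv_eq_of_mul_eq_one_right (by decide)

theorem zmod_five_inv_three : (3 : ZMod 5)⁻¹ = 2 := inv_eq_of_mul_eq_one_right (by decide)

theorem zmod_five_inv_four : (4 : ZMod 5)⁻¹ = 4 := inv_eq_of_mul_eq_one_right (by decide)

theorem zmod_five_cases {c : ZMod 5} (hc : c ≠ 0) : c = 1 ∨ c = 2 ∨ c = 3 ∨ c = 4 := by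
  revert c; decide

theorem weilDiag_one : weilDiag 1 = 1 := by simp [weilDiag]

theorem weilDiag_two : weilDiag 2 = !![0, 1; -1, 0] := by
  simp [weilDiag, show (2 : ZMod 5) ≠ 1 by decide]

theorem weilDiag_three : weilDiag 3 = !![0, -1; 1, 0] := by
  simp [weilDiag, show (3 : ZMod 5) ≠ 1 by decide, show (3 : ZMod 5) ≠ 2 by decide]

theorem weilDiag_four : weilDiag 4 = -1 := by
  simp [weilDiag, show (4 : ZMod 5) ≠ 1 by decide, show (4 : ZMod 5) ≠ 2 by decide,
    show (4 : ZMod 5) ≠ 3 by decide]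

theorem weilDiag_mul {c d : ZMod 5} (hc : c ≠ 0) (hd : d ≠ 0) :
    weilDiag (c * d) = weilDiag c * weilDiag d := by
  have h4 : (2 : ZMod 5) * 2 = 4 := by decide
  have h1 : (2 : ZMod 5) * 3 = 1 := by decide
  have h3 : (2 : ZMod 5) * 4 = 3 := by decide
  have h6 : (3 : ZMod 5) * 2 = 1 := by decide
  have h9 : (3 : ZMod 5) * 3 = 4 := by decide
  have h12 : (3 : ZMod 5) * 4 = 2 := by decide
  have h8 : (4 : ZMod 5) * 2 = 3 := by decide
  have h13 : (4 : ZMod 5) * 3 = 2 := by decide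
  have h16 : (4 : ZMod 5) * 4 = 1 := by decide
  rcases zmod_five_cases hc with rfl | rfl | rfl | rfl <;>
  rcases zmod_five_cases hd with rfl | rfl | rfl | rfl <;>
  simp [*, weilDiag_one, weilDiag_two, weilDiag_three, weilDiag_four, Matrix.one_fin_two]

theorem weilDiag_mul_weilT {c : ZMod 5} (hc : c ≠ 0) (x : ZMod 5) :
    weilDiag c * weilT x = weilT (x * (c⁻¹ * c⁻¹)) * weilDiag c := by
  have h2 : 2 * (x * ((2 : ZMod 5)⁻¹ * 2⁻¹)) = 3 * x := by
    rw [zmod_five_inv_two]; clear * -; revert x; decide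
  have h2' : 3 * (x * ((2 : ZMod 5)⁻¹ * 2⁻¹)) = 2 * x := by
    rw [zmod_five_inv_two]; clear * -; revert x; decide
  have h3 : 2 * (x * ((3 : ZMod 5)⁻¹ * 3⁻¹)) = 3 * x := by
    rw [zmod_five_inv_three]; clear * -; revert x; decide
  have h3' : 3 * (x * ((3 : ZMod 5)⁻¹ * 3⁻¹)) = 2 * x := by
    rw [zmod_five_inv_three]; clear * -; revert x; decide
  have h4 : x * ((4 : ZMod 5)⁻¹ * 4⁻¹) = x := by
    rw [zmod_five_inv_four]; clear * -; revert x; decide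
  rcases zmod_five_cases hc with rfl | rfl | rfl | rfl
  · simp [weilDiag_one]
  · simp [weilDiag_two, weilT, h2, h2']
  · simp [weilDiag_three, weilT, h3, h3']
  · simp [weilDiag_four, h4]

/-- Up to sign, `weilS` is the Fourier kernel (ζ^{xy} - ζ^{-xy})/√5 on odd functions on ℤ/5, with x,
y ∈ {1, 2}. With √5 written as ζ - ζ² - ζ³ + ζ⁴ the entries are polynomials in ζ, and the identity
follows from 1 + ζ + ζ² + ζ³ + ζ⁴ = 0. -/
theorem weilS_mul_weilS : weilS * weilS = -1 := by
  have h := zetaFive_geom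
  rw [weilS, Matrix.one_fin_two]
  generalize zetaFive = z at h ⊢
  ext i j
  fin_cases i <;> fin_cases j <;> simp <;> grind

/-- The relation needed to bring a product back to Bruhat normal form when right multiplication by S
stays in the big cell. -/
theorem weilS_mul_weilT_mul_weilS {x : ZMod 5} (hx : x ≠ 0) :
    weilS * weilT x * weilS = weilT (-x⁻¹) * weilDiag x * weilS * weilT (-x⁻¹) := by
  have h := zetaFive_geom
  have e0 : expFive 0 = 1 := expFive_zero
  have e1 : expFive 1 = zetaFive := pow_one _
  have e2 : expFive 2 = zetaFive ^ 2 := rfl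
  have e3 : expFive 3 = zetaFive ^ 3 := rfl
  have e4 : expFive 4 = zetaFive ^ 4 := rfl
  have t1 : weilT 1 = !![zetaFive ^ 2, 0; 0, zetaFive ^ 3] := by
    rw [weilT, mul_one, mul_one, e2, e3]
  have t2 : weilT 2 = !![zetaFive ^ 4, 0; 0, zetaFive] := by
    rw [weilT, show (2 : ZMod 5) * 2 = 4 by decide, show (3 : ZMod 5) * 2 = 1 by decide, e4, e1]
  have t3 : weilT 3 = !![zetaFive, 0; 0, zetaFive ^ 4] := by
    rw [weilT, show (2 : ZMod 5) * 3 = 1 by decide, show (3 : ZMod 5) * 3 = 4 by decide, e4, e1]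
  have t4 : weilT 4 = !![zetaFive ^ 3, 0; 0, zetaFive ^ 2] := by
    rw [weilT, show (2 : ZMod 5) * 4 = 3 by decide, show (3 : ZMod 5) * 4 = 2 by decide, e2, e3]
  rcases zmod_five_cases hx with rfl | rfl | rfl | rfl
  · rw [show -(1 : ZMod 5)⁻¹ = 4 by rw [inv_one]; decide, t1, t4, weilDiag_one, weilS]
    generalize zetaFive = z at h ⊢
    ext i j
    fin_cases i <;> fin_cases j <;> simp <;> grind
  · rw [show -(2 : ZMod 5)⁻¹ = 2 by rw [zmod_five_inv_two]; decide, t2, weilDiag_two, weilS]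
    generalize zetaFive = z at h ⊢
    ext i j
    fin_cases i <;> fin_cases j <;> simp <;> grind
  · rw [show -(3 : ZMod 5)⁻¹ = 3 by rw [zmod_five_inv_three]; decide, t3, weilDiag_three, weilS]
    generalize zetaFive = z at h ⊢
    ext i j
    fin_cases i <;> fin_cases j <;> simp <;> grind
  · rw [show -(4 : ZMod 5)⁻¹ = 1 by rw [zmod_five_inv_four]; decide, t1, t4, weilDiag_four, weilS]
    generalize zetaFive = z at h ⊢
    ext i j
    fin_cases i <;> fin_cases j <;> simp <;> grind

theorem weilRep_mul_T {m : Matrix (Fin 2) (Fin 2) (ZMod 5)} (hm : m.det = 1) :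
    weilRep (m * !![1, 1; 0, 1]) = weilRep m * weilT 1 := by
  have e (i : Fin 2) : (m * (!![1, 1; 0, 1] : Matrix (Fin 2) (Fin 2) (ZMod 5))) i 0 = m i 0 := by
    simp [Matrix.mul_apply]
  have e' (i : Fin 2) : (m * (!![1, 1; 0, 1] : Matrix (Fin 2) (Fin 2) (ZMod 5))) i 1 = m i 0 + m i 1 := by
    simp [Matrix.mul_apply]
  rw [Matrix.det_fin_two] at hm
  rw [weilRep, weilRep, e, e, e', e']
  split_ifs with hc
  · rw [hc, mul_zero, sub_zero] at hm
    have hd : m 1 1 ≠ 0 := right_ne_zero_of_mul_eq_one hm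
    rw [hc, zero_add, mul_assoc, weilDiag_mul_weilT hd, ← mul_assoc, ← weilT_add,
      eq_inv_of_mul_eq_one_left hm]
    congr 2
    ring
  · rw [mul_assoc _ _ (weilT 1), ← weilT_add]
    congr 2
    field_simp
    ring

theorem weilRep_mul_S {m : Matrix (Fin 2) (Fin 2) (ZMod 5)} (hm : m.det = 1) :
    weilRep (m * !![0, -1; 1, 0]) = weilRep m * weilS := by
  have e (i : Fin 2) : (m * (!![0, -1; 1, 0] : Matrix (Fin 2) (Fin 2) (ZMod 5))) i 0 = m i 1 := by
    simp [Matrix.mul_apply]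
  have e' (i : Fin 2) : (m * (!![0, -1; 1, 0] : Matrix (Fin 2) (Fin 2) (ZMod 5))) i 1 = -m i 0 := by
    simp [Matrix.mul_apply]
  have hneg : (-1 : ZMod 5) = 4 := by decide
  rw [Matrix.det_fin_two] at hm
  rw [weilRep, weilRep, e, e, e', e']
  by_cases hc : m 1 0 = 0
  · rw [hc, mul_zero, sub_zero] at hm
    have hd : m 1 1 ≠ 0 := right_ne_zero_of_mul_eq_one hm
    rw [if_neg hd, if_pos hc, hc, neg_zero, zero_mul, weilT_zero, mul_one]
  rw [if_neg hc]
  by_cases hd : m 1 1 = 0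
  · rw [if_pos hd, hd, zero_mul, weilT_zero, mul_one, mul_assoc _ weilS, weilS_mul_weilS,
      ← weilDiag_four, mul_assoc, ← weilDiag_mul hc (by decide), ← hneg, mul_neg_one, inv_neg,
      neg_mul_neg]
  · rw [if_neg hd]
    have hx : m 1 1 * (m 1 0)⁻¹ ≠ 0 := mul_ne_zero hd (inv_ne_zero hc)
    have h1 : -(m 1 1 * (m 1 0)⁻¹)⁻¹ = -m 1 0 * (m 1 1)⁻¹ := by field_simp
    have h2 : m 1 0 * (m 1 1 * (m 1 0)⁻¹) = m 1 1 := by field_simp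
    have h3 : m 0 0 * (m 1 0)⁻¹ + -m 1 0 * (m 1 1)⁻¹ * ((m 1 0)⁻¹ * (m 1 0)⁻¹) =
        m 0 1 * (m 1 1)⁻¹ := by
      field_simp
      linear_combination hm
    have h4 := weilS_mul_weilT_mul_weilS hx
    rw [h1] at h4
    calc _ = weilT (m 0 0 * (m 1 0)⁻¹) * (weilT (-m 1 0 * (m 1 1)⁻¹ * ((m 1 0)⁻¹ * (m 1 0)⁻¹)) *
          weilDiag (m 1 0) * weilDiag (m 1 1 * (m 1 0)⁻¹)) * weilS * weilT (-m 1 0 * (m 1 1)⁻¹) := by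
          rw [mul_assoc _ (weilDiag (m 1 0)), ← weilDiag_mul hc hx, h2, ← mul_assoc, ← weilT_add,
            h3]
      _ = weilT (m 0 0 * (m 1 0)⁻¹) * weilDiag (m 1 0) *
          (weilS * weilT (m 1 1 * (m 1 0)⁻¹) * weilS) := by
          rw [← weilDiag_mul_weilT hc, h4]
          simp only [mul_assoc]
      _ = _ := by simp only [mul_assoc]

theorem weilRep_one : weilRep 1 = 1 := by
  simp [weilRep, weilT_zero, weilDiag_one]

/-- The value of `weilRep` at the reduction of `γ` modulo `5`. -/
def weilRepInt (γ : SL(2, ℤ)) : Matrix (Fin 2) (Fin 2) ℂ :=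
  weilRep ((γ : Matrix (Fin 2) (Fin 2) ℤ).map (Int.castRingHom (ZMod 5)))

theorem weilRepInt_one : weilRepInt 1 = 1 := by
  simp [weilRepInt, weilRep_one]

theorem det_map_castRingHom (γ : SL(2, ℤ)) :
    ((γ : Matrix (Fin 2) (Fin 2) ℤ).map (Int.castRingHom (ZMod 5))).det = 1 := by
  have := (Int.castRingHom (ZMod 5)).map_det (γ : Matrix (Fin 2) (Fin 2) ℤ)
  rw [γ.det_coe, map_one] at this
  exact this.symm

theorem weilRepInt_mul_T (γ : SL(2, ℤ)) :
    weilRepInt (γ * ModularGroup.T) = weilRepInt γ * weilT 1 := by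
  rw [weilRepInt, weilRepInt, ← weilRep_mul_T (det_map_castRingHom γ),
    Matrix.SpecialLinearGroup.coe_mul, Matrix.map_mul, ModularGroup.coe_T]
  congr 2
  ext i j
  fin_cases i <;> fin_cases j <;> simp

theorem weilRepInt_mul_S (γ : SL(2, ℤ)) :
    weilRepInt (γ * ModularGroup.S) = weilRepInt γ * weilS := by
  rw [weilRepInt, weilRepInt, ← weilRep_mul_S (det_map_castRingHom γ),
    Matrix.SpecialLinearGroup.coe_mul, Matrix.map_mul, ModularGroup.coe_S]
  congr 2
  ext i j
  fin_cases i <;> fin_cases j <;> simp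

theorem weilRepInt_T : weilRepInt ModularGroup.T = weilT 1 := by
  simpa [weilRepInt_one] using weilRepInt_mul_T 1

theorem weilRepInt_S : weilRepInt ModularGroup.S = weilS := by
  simpa [weilRepInt_one] using weilRepInt_mul_S 1

/-- Right multiplication by S and T suffices, as they generate; g stays arbitrary in the induction
so that products and inverses can be handled. -/
theorem weilRepInt_mul (g γ : SL(2, ℤ)) : weilRepInt (g * γ) = weilRepInt g * weilRepInt γ := by
  have hγ : γ ∈ Subgroup.closure {ModularGroup.S, ModularGroup.T} := by
    simp [SpecialLinearGroup.SL2Z_generators]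
  induction hγ using Subgroup.closure_induction generalizing g with
  | mem x hx =>
    rcases hx with rfl | rfl
    · rw [weilRepInt_mul_S, weilRepInt_S]
    · rw [weilRepInt_mul_T, weilRepInt_T]
  | one => rw [weilRepInt_one, mul_one, mul_one]
  | mul x y _ _ hx hy => rw [← mul_assoc, hy, hx, mul_assoc, ← hy]
  | inv x _ hx =>
    have h1 : weilRepInt x * weilRepInt x⁻¹ = 1 := by
      rw [mul_eq_one_comm, ← hx, inv_mul_cancel, weilRepInt_one]
    have h2 := hx (g * x⁻¹)
    rw [inv_mul_cancel_right] at h2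
    rw [h2, mul_assoc, h1, mul_one]

theorem weilRepInt_of_mem_Gamma {γ : SL(2, ℤ)} (hγ : γ ∈ CongruenceSubgroup.Gamma 5) :
    weilRepInt γ = 1 := by
  rw [CongruenceSubgroup.Gamma_mem] at hγ
  rw [weilRepInt, ← weilRep_one]
  congr 1
  ext i j
  fin_cases i <;> fin_cases j <;> simp [hγ]

/-! ### Comparison of ρ(S) and ρ(T) with the representation modulo 5 -/

theorem expFive_two : expFive 2 = zetaFive ^ 2 := rfl

theorem expFive_three : expFive 3 = zetaFive ^ 3 := rfl

theorem rrMatrixT_eq_smul_weilT :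
    rrMatrixT = Complex.exp (7 * (2 * Real.pi * Complex.I) / 12) • weilT 1 := by
  rw [weilT, mul_one, mul_one, expFive_two, expFive_three, zetaFive, ← Complex.exp_nat_mul,
    ← Complex.exp_nat_mul, rrMatrixT]
  ext i j
  fin_cases i <;> fin_cases j
  · simp [← Complex.exp_add]
    -- -1/60 = 7/12 + 2/5 - 1; the other eigenvalue uses 11/60 = 7/12 + 3/5 - 1.
    refine exp_eq_exp_of_int (-1) ?_
    push_cast; ring
  · simp
  · simp
  · simp [← Complex.exp_add]
    refine exp_eq_exp_of_int (-1) ?_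
    push_cast; ring

theorem zetaFive_inv : zetaFive⁻¹ = zetaFive ^ 4 :=
  inv_eq_of_mul_eq_one_right (by rw [← pow_succ', isPrimitiveRoot_zetaFive.pow_eq_one])

theorem two_mul_cos_two_pi_div_five :
    ((2 * Real.cos (2 * Real.pi / 5) : ℝ) : ℂ) = zetaFive + zetaFive ^ 4 := by
  rw [← zetaFive_inv, zetaFive, ← Complex.exp_neg]
  push_cast
  rw [Complex.two_cos]
  congr 2 <;> ring

theorem sqrt_five_eq :
    ((Real.sqrt 5 : ℝ) : ℂ) = zetaFive + zetaFive ^ 4 - zetaFive ^ 2 - zetaFive ^ 3 := by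
  have h : ((Real.sqrt 5 : ℝ) : ℂ) = 2 * ((2 * Real.cos (2 * Real.pi / 5) : ℝ) : ℂ) + 1 := by
    have h1 := Real.cos_pi_div_five
    have h2 := Real.cos_two_mul (Real.pi / 5)
    have h3 : Real.sqrt 5 ^ 2 = 5 := Real.sq_sqrt (by norm_num)
    have h4 : Real.sqrt 5 = 2 * (2 * Real.cos (2 * Real.pi / 5)) + 1 := by
      rw [show 2 * Real.pi / 5 = 2 * (Real.pi / 5) by ring, h2, h1]
      linear_combination -h3 / 2
    exact_mod_cast h4
  rw [h, two_mul_cos_two_pi_div_five]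
  linear_combination zetaFive_geom

theorem sin_two_pi_div_five_eq :
    (Real.sin (2 * Real.pi / 5) : ℂ) = -Complex.I * (zetaFive - zetaFive ^ 4) / 2 := by
  rw [← zetaFive_inv, zetaFive, ← Complex.exp_neg]
  push_cast
  rw [Complex.sin, div_left_inj' two_ne_zero,
    show 2 * (Real.pi : ℂ) * Complex.I / 5 = 2 * Real.pi / 5 * Complex.I by ring]
  ring_nf

theorem sin_pi_div_five_eq :
    (Real.sin (Real.pi / 5) : ℂ) = -Complex.I * (zetaFive ^ 2 - zetaFive ^ 3) / 2 := by
  have h : zetaFive ^ 3 = (zetaFive ^ 2)⁻¹ :=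
    (inv_eq_of_mul_eq_one_right
      (by rw [← pow_add, isPrimitiveRoot_zetaFive.pow_eq_one])).symm
  rw [show Real.pi / 5 = Real.pi - 4 * Real.pi / 5 by ring, Real.sin_pi_sub, h, zetaFive,
    ← Complex.exp_nat_mul, ← Complex.exp_neg]
  push_cast
  rw [Complex.sin, div_left_inj' two_ne_zero,
    show 2 * (2 * (Real.pi : ℂ) * Complex.I / 5) = 4 * Real.pi / 5 * Complex.I by ring]
  ring_nf

theorem rrMatrixS_eq_smul_weilS : rrMatrixS = Complex.I • weilS := by
  have h5 : ((2 / Real.sqrt 5 : ℝ) : ℂ) =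
      2 * (zetaFive + zetaFive ^ 4 - zetaFive ^ 2 - zetaFive ^ 3) / 5 := by
    rw [← sqrt_five_eq]
    have h3 : Real.sqrt 5 ^ 2 = 5 := Real.sq_sqrt (by norm_num)
    have h4 : 2 / Real.sqrt 5 = 2 * Real.sqrt 5 / 5 := by
      have : Real.sqrt 5 ≠ 0 := by positivity
      field_simp
      linarith
    exact_mod_cast h4
  have h := zetaFive_geom
  rw [rrMatrixS, h5, sin_two_pi_div_five_eq, sin_pi_div_five_eq, weilS]
  generalize zetaFive = z at h ⊢
  ext i j
  fin_cases i <;> fin_cases j <;> simp <;> grind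

theorem rrMatrixS_mul_self : rrMatrixS * rrMatrixS = 1 := by
  rw [rrMatrixS_eq_smul_weilS, Matrix.smul_mul, Matrix.mul_smul, smul_smul, weilS_mul_weilS,
    Complex.I_mul_I, neg_smul_neg, one_smul]

theorem det_rrMatrixT_ne_zero : rrMatrixT.det ≠ 0 := by
  simp [rrMatrixT, Matrix.det_fin_two]

/-! ### The representation ρ and its level -/

/-- Linear independence applied to each row of M - N. This uniqueness makes the matrices chosen for
each γ multiplicative. -/
theorem eq_of_forall_mulVec_rrVector {M N : Matrix (Fin 2) (Fin 2) ℂ}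
    (h : ∀ τ, M.mulVec (rrVector τ) = N.mulVec (rrVector τ)) : M = N := by
  have hrow (i : Fin 2) : M i 0 - N i 0 = 0 ∧ M i 1 - N i 1 = 0 := by
    refine rrVector_linearIndependent fun τ => ?_
    have := congrFun (h τ) i
    simp only [Matrix.mulVec, dotProduct, Fin.sum_univ_two] at this
    linear_combination this
  ext i j
  fin_cases j
  · exact sub_eq_zero.mp (hrow i).1
  · exact sub_eq_zero.mp (hrow i).2

theorem rrVector_T_smul (τ : ℍ) :
    rrVector (ModularGroup.T • τ) = rrMatrixT.mulVec (rrVector τ) := by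
  rw [UpperHalfPlane.modular_T_smul, rrVector_one_vadd]

theorem rrVector_S_smul (τ : ℍ) :
    rrVector (ModularGroup.S • τ) = rrMatrixS.mulVec (rrVector τ) := by
  rw [UpperHalfPlane.modular_S_smul, rrVector_neg_inv]

theorem exists_rrVector_smul (γ : SL(2, ℤ)) : ∃ M : GL (Fin 2) ℂ,
    ∀ τ, rrVector (γ • τ) = (M : Matrix (Fin 2) (Fin 2) ℂ).mulVec (rrVector τ) := by
  have hγ : γ ∈ Subgroup.closure {ModularGroup.S, ModularGroup.T} := by
    simp [SpecialLinearGroup.SL2Z_generators]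
  induction hγ using Subgroup.closure_induction with
  | mem x hx =>
    rcases hx with rfl | rfl
    · exact ⟨⟨rrMatrixS, rrMatrixS, rrMatrixS_mul_self, rrMatrixS_mul_self⟩, rrVector_S_smul⟩
    · exact ⟨Matrix.GeneralLinearGroup.mkOfDetNeZero rrMatrixT det_rrMatrixT_ne_zero,
        rrVector_T_smul⟩
  | one => exact ⟨1, fun τ => by simp⟩
  | mul x y _ _ hx hy =>
    obtain ⟨M, hM⟩ := hx
    obtain ⟨N, hN⟩ := hy
    exact ⟨M * N, fun τ => by rw [mul_smul, hM, hN, Matrix.mulVec_mulVec, Units.val_mul]⟩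
  | inv x _ hx =>
    obtain ⟨M, hM⟩ := hx
    refine ⟨M⁻¹, fun τ => ?_⟩
    have := hM (x⁻¹ • τ)
    rw [smul_inv_smul] at this
    rw [this, Matrix.mulVec_mulVec, ← Units.val_mul, inv_mul_cancel, Units.val_one,
      Matrix.one_mulVec]

/-- The representation of `SL₂(ℤ)` under which the Rogers–Ramanujan pair transforms. -/
def rrRep : SL(2, ℤ) →* GL (Fin 2) ℂ :=
  MonoidHom.mk' (fun γ => (exists_rrVector_smul γ).choose) fun x y => by
    refine Units.ext (eq_of_forall_mulVec_rrVector fun τ => ?_)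
    rw [← (exists_rrVector_smul (x * y)).choose_spec, mul_smul,
      (exists_rrVector_smul x).choose_spec, (exists_rrVector_smul y).choose_spec,
      Matrix.mulVec_mulVec, Units.val_mul]

theorem rrVector_smul (γ : SL(2, ℤ)) (τ : ℍ) :
    rrVector (γ • τ) = (rrRep γ : Matrix (Fin 2) (Fin 2) ℂ).mulVec (rrVector τ) :=
  (exists_rrVector_smul γ).choose_spec τ

theorem rrRep_T : (rrRep ModularGroup.T : Matrix (Fin 2) (Fin 2) ℂ) = rrMatrixT :=
  eq_of_forall_mulVec_rrVector fun τ => by rw [← rrVector_smul, rrVector_T_smul]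

theorem rrRep_S : (rrRep ModularGroup.S : Matrix (Fin 2) (Fin 2) ℂ) = rrMatrixS :=
  eq_of_forall_mulVec_rrVector fun τ => by rw [← rrVector_smul, rrVector_S_smul]

theorem isVVModularFunction_rrRep : IsVVModularFunction rrRep rrVector where
  holomorphic := mdifferentiable_rrVector
  transform := rrVector_smul
  meromorphic_cusps γ j := by
    simpa only [rrVector_smul, Matrix.mulVec, dotProduct, Fin.sum_univ_two] using
      meromorphicAtInfty_linearCombination_rrVector _ _

theorem exists_rrRep_eq_smul_weilRepInt (γ : SL(2, ℤ)) :
    ∃ c : ℂˣ, (rrRep γ : Matrix (Fin 2) (Fin 2) ℂ) = (c : ℂ) • weilRepInt γ := by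
  have hγ : γ ∈ Subgroup.closure {ModularGroup.S, ModularGroup.T} := by
    simp [SpecialLinearGroup.SL2Z_generators]
  induction hγ using Subgroup.closure_induction with
  | mem x hx =>
    rcases hx with rfl | rfl
    · exact ⟨Units.mk0 _ Complex.I_ne_zero, by
        rw [rrRep_S, weilRepInt_S, rrMatrixS_eq_smul_weilS, Units.val_mk0]⟩
    · exact ⟨Units.mk0 _ (Complex.exp_ne_zero _), by
        rw [rrRep_T, weilRepInt_T, rrMatrixT_eq_smul_weilT, Units.val_mk0]⟩
  | one => exact ⟨1, by simp [weilRepInt_one]⟩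
  | mul x y _ _ hx hy =>
    obtain ⟨c, hc⟩ := hx
    obtain ⟨d, hd⟩ := hy
    exact ⟨c * d, by
      rw [map_mul, Units.val_mul, hc, hd, weilRepInt_mul, Matrix.smul_mul, Matrix.mul_smul,
        smul_smul, Units.val_mul]⟩
  | inv x _ hx =>
    obtain ⟨c, hc⟩ := hx
    refine ⟨c⁻¹, ?_⟩
    rw [map_inv, ← Units.mul_right_inj (rrRep x), Units.mul_inv, hc, Matrix.smul_mul,
      Matrix.mul_smul, smul_smul, Units.mul_inv, one_smul, ← weilRepInt_mul, mul_inv_cancel,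
      weilRepInt_one]

theorem weilRepInt_ne_zero (γ : SL(2, ℤ)) : weilRepInt γ ≠ 0 := fun h => by
  have := weilRepInt_mul γ γ⁻¹
  rw [mul_inv_cancel, weilRepInt_one, h, zero_mul] at this
  exact one_ne_zero this

/-- The character by which `rrRep` differs from a representation of `SL₂(ℤ/5)`. -/
def rrCharacter : SL(2, ℤ) →* ℂˣ :=
  MonoidHom.mk' (fun γ => (exists_rrRep_eq_smul_weilRepInt γ).choose) fun x y => by
    -- The scalar is determined by γ because `weilRepInt` never vanishes, hence it is
    -- multiplicative.
    refine Units.ext (smul_left_injective ℂ (weilRepInt_ne_zero (x * y)) ?_)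
    have hx := (exists_rrRep_eq_smul_weilRepInt x).choose_spec
    have hy := (exists_rrRep_eq_smul_weilRepInt y).choose_spec
    have hxy := (exists_rrRep_eq_smul_weilRepInt (x * y)).choose_spec
    beta_reduce
    rw [← hxy]
    generalize (exists_rrRep_eq_smul_weilRepInt x).choose = c at hx ⊢
    generalize (exists_rrRep_eq_smul_weilRepInt y).choose = d at hy ⊢
    rw [map_mul, Units.val_mul, hx, hy, weilRepInt_mul, Matrix.smul_mul, Matrix.mul_smul,
      smul_smul, Units.val_mul]

theorem rrRep_eq_smul_weilRepInt (γ : SL(2, ℤ)) :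
    (rrRep γ : Matrix (Fin 2) (Fin 2) ℂ) = (rrCharacter γ : ℂ) • weilRepInt γ :=
  (exists_rrRep_eq_smul_weilRepInt γ).choose_spec

theorem actsByMultiplier_rrRep_five : ActsByMultiplier rrRep 5 :=
  ⟨rrCharacter, fun γ hγ => by rw [rrRep_eq_smul_weilRepInt, weilRepInt_of_mem_Gamma hγ]⟩

theorem rrMatrixT_pow (n : ℕ) : rrMatrixT ^ n =
    !![Complex.exp (n * (-(2 * Real.pi * Complex.I) / 60)), 0;
       0, Complex.exp (n * (11 * (2 * Real.pi * Complex.I) / 60))] := by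
  have h : rrMatrixT = Matrix.diagonal ![Complex.exp (-(2 * Real.pi * Complex.I) / 60),
      Complex.exp (11 * (2 * Real.pi * Complex.I) / 60)] := by
    ext i j
    fin_cases i <;> fin_cases j <;> simp [rrMatrixT]
  rw [h, Matrix.diagonal_pow]
  ext i j
  fin_cases i <;> fin_cases j <;> simp [Complex.exp_nat_mul]

/-- T^M lies in Γ(M), so its two eigenvalues must coincide; their ratio is e^{2πiM/5}. -/
theorem five_dvd_of_actsByMultiplier_rrRep {M : ℕ} (h : ActsByMultiplier rrRep M) : 5 ∣ M := by
  obtain ⟨χ, hχ⟩ := h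
  have hT : ModularGroup.T ^ M ∈ CongruenceSubgroup.Gamma M := by
    rw [CongruenceSubgroup.Gamma_mem, ← zpow_natCast, ModularGroup.coe_T_zpow]
    simp
  have h1 := hχ _ hT
  rw [map_pow, Units.val_pow_eq_pow_val, rrRep_T, rrMatrixT_pow] at h1
  have h00 := congrFun (congrFun h1 0) 0
  have h11 := congrFun (congrFun h1 1) 1
  simp at h00 h11
  rw [← h11, Complex.exp_eq_exp_iff_exists_int] at h00
  obtain ⟨n, hn⟩ := h00
  have h0 : (2 * Real.pi * Complex.I) ≠ 0 := by simp [Real.pi_ne_zero]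
  have h2 : -(M : ℂ) = 5 * n := mul_left_cancel₀ h0 (by linear_combination 5 * hn)
  have h3 : -(M : ℤ) = 5 * n := by exact_mod_cast h2
  omega

theorem hasLevel_rrRep : HasLevel rrRep 5 :=
  ⟨⟨by norm_num, actsByMultiplier_rrRep_five⟩,
    fun _ hM => Nat.le_of_dvd hM.1 (five_dvd_of_actsByMultiplier_rrRep hM.2)⟩

end

theorem mainTheorem2 :
    (∀ q : ℂ, ‖q‖ < 1 →
      Summable (fun n => ‖rrTermG q n‖) ∧ Summable (fun n => ‖rrTermH q n‖)) ∧
    (∃ ρ : SL(2, ℤ) →* GL (Fin 2) ℂ,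
      IsVVModularFunction ρ rrVector ∧ HasLevel ρ 5 ∧
      (ρ ModularGroup.T : Matrix (Fin 2) (Fin 2) ℂ) = rrMatrixT ∧
      (ρ ModularGroup.S : Matrix (Fin 2) (Fin 2) ℂ) = rrMatrixS) ∧
    (∀ τ : ℍ, rrVector ((1 : ℝ) +ᵥ τ) = rrMatrixT.mulVec (rrVector τ)) ∧
    (∀ τ : ℍ, rrVector (UpperHalfPlane.mk (-(τ : ℂ))⁻¹ τ.im_inv_neg_coe_pos) =
      rrMatrixS.mulVec (rrVector τ)) := by
  refine ⟨fun q hq => ?_, ⟨rrRep, isVVModularFunction_rrRep, hasLevel_rrRep, rrRep_T, rrRep_S⟩,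
    rrVector_one_vadd, rrVector_neg_inv⟩
  rw [rrTermG_eq, rrTermH_eq]
  exact ⟨summable_norm_rrTerm hq 0, summable_norm_rrTerm hq 1⟩
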